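/- Let $A,B\ge 1$ be integers, let $0<q<1$, and let $\pi=(\pi_1\ge\dots\ge\pi_A\ge 0)$ be a Young diagram contained in the rectangle $B^A$ ($A$ rows, $B$ columns). A skew plane partition $\Pi$ with support $B^A/\pi$ is a filling of the boxes of $B^A/\pi$ by nonnegative integers $\Pi_{i,j}$ with $\Pi_{i,j}\ge \Pi_{i+1,j}$ and $\Pi_{i,j}\ge\Pi_{i,j+1}$ whenever both boxes lie in the support. Let $\Pi$ be random with $\mathrm{Prob}\{\Pi\}$ proportional to $q^{\sum_{i,j}\Pi_{i,j}}$. For $1\le k\le A+B+1$ let $\lambda^{(k)}=\lambda^{(k)}(\Pi)$ be the Young diagram whose parts are the nonzero entries $\Pi_{i,j}$ on the diagonal $j-i=k-A-1$ of the support. Let $\mathcal L(\pi)=\{A+\pi_i-i+1 : 1\le i\le A\}$. Number the lattice points of the boundary path of $B^A/\pi$ (from the bottom left to the top right corner) by $1,\dots,A+B+1$; the step from $j$ to $j+1$ is vertical exactly when $j\in\mathcal L(\pi)$. Let $l$ be the number of maximal vertical segments of this path and let $\beta_1>\beta_2>\dots>\beta_{2l}$ be their end points, so that the $k$-th segment from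 the top joins the points $\beta_{2k}$ and $\beta_{2k-1}$. In particular $\beta_1=A+\pi_1+1$ and $\beta_{2l}=1+\pi_A$. Let $p\ge1$ and let $\alpha_1,\dots,\alpha_p$ be integers with $\beta_2\le\alpha_1<\dots<\alpha_p<\beta_1$. For Young diagrams $\lambda^1,\dots,\lambda^p$ put $$ \begin{aligned} W(\lambda^1,\dots,\lambda^p)={}&s_{\lambda^p}\left(1,q,\dots,q^{B-\pi_1-1}\right) \prod_{k=1}^{p-1}s_{\lambda^{k+1}/\lambda^{k}}\left(q^{A+\pi_1+2-\alpha_{k+1}},q^{A+\pi_1+3-\alpha_{k+1}},\dots,q^{A+\pi_1+1-\alpha_k}\right)\\ &\times s_{\lambda^1}\Bigl(q^{A+\pi_1+2-\alpha_1},\dots,q^{A+\pi_1+1-\beta_2};\; q^{A+\pi_1+2-\beta_3},\dots,q^{A+\pi_1+1-\beta_4};\;\dots;\; q^{A+\pi_1+2-\beta_{2l-1}},\dots,q^{A+\pi_1+1-\beta_{2l}}\Bigr), \end{aligned} $$ where $s_\lambda$, $s_{\lambda/\mu}$ are (skew) Schur functions evaluated at the listed finitely many variables, and a geometric series $q^t,q^{t+1},\dots,q^s$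 with $t>s$ is empty. (If $\pi_A=0$, the last exponent is $A+\pi_1+1-\beta_{2l}=A+\pi_1$; if $l=1$, only the first series is present in the last factor.) Then $Z=\sum_{\lambda^1,\dots,\lambda^p}W(\lambda^1,\dots,\lambda^p)$ converges, $Z>0$, and for all Young diagrams $\lambda^1,\dots,\lambda^p$ $$ \mathrm{Prob}\left\{\lambda^{(\alpha_1)}(\Pi)=\lambda^1,\dots,\lambda^{(\alpha_p)}(\Pi)=\lambda^p\right\}=\frac1Z\,W(\lambda^1,\dots,\lambda^p). $$ The same number is the probability that the random point configuration $\bigcup_{k=1}^p\{(k,\lambda^{(\alpha_k)}_i(\Pi)-i)\}_{i\ge1}$ in $\{1,\dots,p\}\times\mathbb Z$ equals $\bigcup_{k=1}^p\{(k,\lambda^{k}_i-i)\}_{i\ge1}$. -/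

import Mathlib

noncomputable section

open scoped ENNReal

namespace SkewPP

/-! Rows and columns of diagrams are numbered from `0` (as in Mathlib's `YoungDiagram`): the box in
row `i + 1` and column `j + 1` of the mathematical text is the pair `(i, j)`, and the part
`π_{i+1}` is `π.rowLen i`. -/

/-- The rectangle `B^A`: `A` rows, each of length `B`. -/
def rectangle (A B : ℕ) : YoungDiagram where
  cells := Finset.range A ×ˢ Finset.range B
  isLowerSet := by
    rintro ⟨i, j⟩ ⟨i', j'⟩ ⟨hi, hj⟩ h
    simp only [Finset.coe_product, Finset.coe_range, Set.mem_prod, Set.mem_Iio] at h ⊢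
    exact ⟨lt_of_le_of_lt hi h.1, lt_of_le_of_lt hj h.2⟩

/-- The boxes of the skew diagram `lam / mu`. -/
def skewCells (lam mu : YoungDiagram) : Finset (ℕ × ℕ) := lam.cells \ mu.cells

/-! ### Skew plane partitions -/

/-- A skew plane partition with support `B^A / π`: a filling of the boxes of `B^A / π` by
nonnegative integers, weakly decreasing along rows and down columns. (The filling is extended by
`0` outside the support, so that equality of fillings is equality on the support.) -/
@[ext]
structure SkewPlanePartition (A B : ℕ) (π : YoungDiagram) where
  entry : ℕ × ℕ → ℕ
  zero_outside : ∀ c, c ∉ skewCells (rectangle A B) π → entry c = 0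
  col_weak : ∀ i j, (i, j) ∈ skewCells (rectangle A B) π →
    (i + 1, j) ∈ skewCells (rectangle A B) π → entry (i + 1, j) ≤ entry (i, j)
  row_weak : ∀ i j, (i, j) ∈ skewCells (rectangle A B) π →
    (i, j + 1) ∈ skewCells (rectangle A B) π → entry (i, j + 1) ≤ entry (i, j)

namespace SkewPlanePartition

variable {A B : ℕ} {π : YoungDiagram}

/-- The volume, i.e. the sum of all entries. -/
def volume (P : SkewPlanePartition A B π) : ℕ :=
  ∑ c ∈ skewCells (rectangle A B) π, P.entry c

end SkewPlanePartition

/-- The Young diagram whose row lengths are the nonzero elements of a finite multiset. -/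
def ofParts (s : Multiset ℕ) : YoungDiagram :=
  YoungDiagram.ofRowLens (s.sort (· ≥ ·)) (Multiset.pairwise_sort s (· ≥ ·)).sortedGE

/-- The diagonal slice `λ^{(k)}`: its parts are the entries in the boxes of the support with
`(column) - (row) = k - A - 1`. -/
def SkewPlanePartition.slice {A B : ℕ} {π : YoungDiagram} (P : SkewPlanePartition A B π) (k : ℕ) :
    YoungDiagram :=
  ofParts (((skewCells (rectangle A B) π).filter
    (fun c => (c.2 : ℤ) - (c.1 : ℤ) = (k : ℤ) - (A : ℤ) - 1)).val.map P.entry)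

/-- The constant zero filling. -/
def zeroPP (A B : ℕ) (π : YoungDiagram) : SkewPlanePartition A B π where
  entry := fun _ => 0
  zero_outside := fun _ _ => rfl
  col_weak := fun _ _ _ _ => le_rfl
  row_weak := fun _ _ _ _ => le_rfl

theorem tsum_weight_ne_zero (A B : ℕ) (π : YoungDiagram) (q : ℝ) :
    (∑' P : SkewPlanePartition A B π, ENNReal.ofReal (q ^ P.volume)) ≠ 0 := by
  intro h
  have h0 := (ENNReal.tsum_eq_zero.1 h) (zeroPP A B π)
  simp [SkewPlanePartition.volume, zeroPP] at h0

theorem tsum_weight_ne_top (A B : ℕ) (π : YoungDiagram) (q : ℝ) (hq0 : 0 < q) (hq1 : q < 1) :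
    (∑' P : SkewPlanePartition A B π, ENNReal.ofReal (q ^ P.volume)) ≠ ∞ := by
  classical
  set S := skewCells (rectangle A B) π with hS
  have key : ∀ s : Finset (SkewPlanePartition A B π),
      ∑ P ∈ s, q ^ P.volume ≤ ((1 - q)⁻¹) ^ S.card := by
    intro s
    let N := (s.sup fun P => P.volume) + 1
    let f : SkewPlanePartition A B π → (S → ℕ) := fun P c => P.entry c
    have hinj : Function.Injective f := by
      intro P Q h
      ext c
      by_cases hc : c ∈ S
      · exact congrFun h ⟨c, hc⟩
      · rw [P.zero_outside c hc, Q.zero_outside c hc]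
    have hvol : ∀ P : SkewPlanePartition A B π, q ^ P.volume = ∏ c : S, q ^ (f P c) := by
      intro P
      rw [Finset.prod_pow_eq_pow_sum, SkewPlanePartition.volume, ← hS,
        ← Finset.sum_coe_sort S]
    have hle : ∀ P ∈ s, ∀ c : S, f P c < N := by
      intro P hP c
      have h1 : P.entry c ≤ P.volume :=
        Finset.single_le_sum (f := P.entry) (fun _ _ => Nat.zero_le _) c.2
      have h2 : P.volume ≤ s.sup fun P => P.volume :=
        Finset.le_sup (f := fun P : SkewPlanePartition A B π => P.volume) hP
      exact Nat.lt_succ_of_le (h1.trans h2)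
    calc ∑ P ∈ s, q ^ P.volume = ∑ g ∈ s.image f, ∏ c : S, q ^ (g c) := by
          rw [Finset.sum_image hinj.injOn]
          exact Finset.sum_congr rfl fun P _ => hvol P
      _ ≤ ∑ g ∈ Fintype.piFinset (fun _ : S => Finset.range N), ∏ c : S, q ^ (g c) := by
          apply Finset.sum_le_sum_of_subset_of_nonneg
          · intro g hg
            obtain ⟨P, hP, rfl⟩ := Finset.mem_image.1 hg
            simpa [Fintype.mem_piFinset] using fun a b h => hle P hP ⟨(a, b), h⟩
          · intros
            positivity
      _ = ∏ _c : S, ∑ j ∈ Finset.range N, q ^ j := by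
          rw [Finset.prod_univ_sum]
      _ ≤ ∏ _c : S, (1 - q)⁻¹ := by
          apply Finset.prod_le_prod
          · intros
            positivity
          · intro _ _
            rw [← tsum_geometric_of_lt_one hq0.le hq1]
            exact (summable_geometric_of_lt_one hq0.le hq1).sum_le_tsum _
              (fun _ _ => by positivity)
      _ = ((1 - q)⁻¹) ^ S.card := by simp
  have hsum : Summable fun P : SkewPlanePartition A B π => q ^ P.volume :=
    summable_of_sum_le (fun _ => by positivity) key
  exact hsum.tsum_ofReal_ne_top

/-- The probability measure on skew plane partitions with support `B^A / π` for which the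
probability of `P` is proportional to `q ^ volume P`. -/
def volumeMeasure (A B : ℕ) (π : YoungDiagram) (q : ℝ) (hq0 : 0 < q) (hq1 : q < 1) :
    PMF (SkewPlanePartition A B π) :=
  PMF.normalize (fun P => ENNReal.ofReal (q ^ P.volume)) (tsum_weight_ne_zero A B π q)
    (tsum_weight_ne_top A B π q hq0 hq1)

/-! ### The boundary of `B^A / π` -/

/-- The set `L(π) = {A + π_i - i + 1 : 1 ≤ i ≤ A}`. The boundary path of `B^A / π` from the
bottom left to the top right runs through points numbered `1, …, A + B + 1`; `j` belongs to `L(π)`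
if and only if the step from point `j` to point `j + 1` is vertical. -/
def verticalSteps (A : ℕ) (π : YoungDiagram) : Finset ℕ :=
  (Finset.range A).image fun i => A + π.rowLen i - i

/-- The end points of the (maximal) vertical segments of the boundary: the points which are
adjacent to exactly one vertical step. -/
def segmentEnds (A : ℕ) (π : YoungDiagram) : Finset ℕ :=
  symmDiff (verticalSteps A π) ((verticalSteps A π).image (· + 1))

/-- The number `l` of vertical segments of the boundary, counted by their lower end points. -/
def numSegments (A : ℕ) (π : YoungDiagram) : ℕ :=
  (verticalSteps A π \ (verticalSteps A π).image (· + 1)).card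

/-- The end points `β_1 > β_2 > … > β_{2l}` of the vertical segments, in decreasing order. Thus
the vertical segments are `[β_{2k}, β_{2k-1}]`, `1 ≤ k ≤ l`, numbered from top to bottom. Only the
values at `1 ≤ k ≤ 2l` are meaningful. -/
def beta (A : ℕ) (π : YoungDiagram) (k : ℕ) : ℕ :=
  ((segmentEnds A π).sort (· ≥ ·)).getD (k - 1) 0

/-! ### Skew Schur functions of finitely many variables -/

/-- A filling of the boxes of `lam / mu` by `0, …, N - 1` is a semistandard tableau if it is weakly
increasing along rows and strictly increasing down columns. -/
def IsSemistandard {lam mu : YoungDiagram} {N : ℕ} (T : skewCells lam mu → Fin N) : Prop :=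
  (∀ c d : skewCells lam mu, c.1.1 = d.1.1 → c.1.2 < d.1.2 → T c ≤ T d) ∧
  (∀ c d : skewCells lam mu, c.1.2 = d.1.2 → c.1.1 < d.1.1 → T c < T d)

open Classical in
/-- The skew Schur function `s_{lam/mu}(x_1, …, x_N)`: the generating function of semistandard
tableaux of shape `lam / mu` if `mu ⊆ lam`, and zero otherwise. -/
def skewSchur (lam mu : YoungDiagram) (x : List ℝ) : ℝ :=
  if mu ≤ lam then
    ∑ T : skewCells lam mu → Fin x.length with IsSemistandard T, ∏ c, x.get (T c)
  else 0

/-- The Schur function `s_lam(x_1, …, x_N)`. -/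
def schur (lam : YoungDiagram) (x : List ℝ) : ℝ := skewSchur lam ⊥ x

/-- The geometric series of variables `(q^t, q^{t+1}, …, q^s)`; it is empty if `t > s`. -/
def geom (q : ℝ) (t s : ℤ) : List ℝ :=
  List.ofFn fun i : Fin (s + 1 - t).toNat => q ^ (t + (i : ℤ))

/-! ### The Schur weight -/

/-- The variables of the Schur function of `λ^{(α_1)}`: the union of the geometric series
`q^{A+π_1+2-α_1}, …, q^{A+π_1+1-β_2}` and, for `k = 2, …, l`,
`q^{A+π_1+2-β_{2k-1}}, …, q^{A+π_1+1-β_{2k}}`. -/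
def initialVariables (A : ℕ) (π : YoungDiagram) (q : ℝ) (a : ℕ) : List ℝ :=
  geom q (A + π.rowLen 0 + 2 - a) (A + π.rowLen 0 + 1 - beta A π 2) ++
    (List.range' 2 (numSegments A π - 1)).flatMap fun k =>
      geom q (A + π.rowLen 0 + 2 - beta A π (2 * k - 1)) (A + π.rowLen 0 + 1 - beta A π (2 * k))

/-- The product of (skew) Schur functions at diagrams `lam 0, …, lam m`, standing for
`λ^{(α_1)}, …, λ^{(α_p)}` with `p = m + 1` and `α_{k+1} = α k`. -/
def schurWeight (A B : ℕ) (π : YoungDiagram) (q : ℝ) {m : ℕ} (α : Fin (m + 1) → ℕ)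
    (lam : Fin (m + 1) → YoungDiagram) : ℝ :=
  schur (lam (Fin.last m)) (geom q 0 (B - π.rowLen 0 - 1)) *
  (∏ k : Fin m, skewSchur (lam k.succ) (lam k.castSucc)
    (geom q (A + π.rowLen 0 + 2 - α k.succ) (A + π.rowLen 0 + 1 - α k.castSucc))) *
  schur (lam 0) (initialVariables A π q (α 0))

/-- The point configuration `⋃_k {(k, λ_i^{(α_k)} - i) : i ≥ 1}` of a sequence of diagrams. -/
def pointConfiguration {m : ℕ} (lam : Fin (m + 1) → YoungDiagram) : Set (Fin (m + 1) × ℤ) :=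
  {x | ∃ i : ℕ, x.2 = ((lam x.1).rowLen i : ℤ) - ((i : ℤ) + 1)}

/-- The slices `λ^{(α_1)}, …, λ^{(α_p)}` of a skew plane partition. -/
def slices {A B : ℕ} {π : YoungDiagram} {m : ℕ} (α : Fin (m + 1) → ℕ)
    (P : SkewPlanePartition A B π) : Fin (m + 1) → YoungDiagram :=
  fun k => P.slice (α k)

end SkewPP

end

/-!
The slices `λ^{(1)} = ∅, λ^{(2)}, …, λ^{(A+B+1)} = ∅` of a skew plane partition are exactly the
sequences of diagrams in which consecutive terms differ by a horizontal strip, added at a vertical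
step of the boundary path and removed at a horizontal one (`IsSliceSequence`). With
`b = A + π_1 + 1`, summation by parts turns `q ^ volume` into a product of weights of the single
steps: `q ^ (b - k)` for each box added and `q ^ (k - b)` for each box removed at the step `k`
(`prod_boundaryKernel_slice_eq`). Hence the total weight of the fillings with prescribed slices is a
matrix element of a product of kernels `Transfer.up x` and `Transfer.down y`, cut at the prescribed
diagrams (`tsum_weight_eq_prod`, `Transfer.segment_restrict_eq_prod`).

A product of upward kernels alone is a skew Schur function (`ofReal_skewSchur_eq_prod`), symmetric
in its variables because upward kernels commute (`Transfer.up_commute`, by the Bender–Knuth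
reflection). This settles the part of the path between the first and the last prescribed slice,
which runs inside the top vertical segment. In the two outer parts upward and downward steps are
mixed, but `Transfer.up_mul_down`, a local form of the Robinson–Schensted–Knuth bijection, says that
`up x * down y` is `down y * up x` times a geometric series in `x * y`. Moving all downward steps of
the initial part to its beginning, where they act on the empty diagram, leaves a Schur function in
the variables of the vertical steps; moving the upward steps of the final part to its end leaves a
Schur function in the variables of the horizontal steps (`Transfer.word_bot_left`,
`Transfer.word_bot_right`). The constants collected on the way do not depend on the prescribed
slices.

All kernels have values in `[0, ∞]`, so that sums can be interchanged freely. Convergence of the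
partition function `Z` of the Schur weights follows at the end from the finiteness of the total
weight of all skew plane partitions.
-/

noncomputable section

open scoped ENNReal

namespace SkewPP

/-! ### Young diagrams through their row lengths -/

theorem ext_rowLen {μ ν : YoungDiagram} (h : ∀ i, μ.rowLen i = ν.rowLen i) : μ = ν := by
  ext ⟨i, j⟩
  rw [YoungDiagram.mem_cells, YoungDiagram.mem_cells, YoungDiagram.mem_iff_lt_rowLen,
    YoungDiagram.mem_iff_lt_rowLen, h]

@[simp]
theorem rowLen_bot (i : ℕ) : (⊥ : YoungDiagram).rowLen i = 0 := by
  by_contra h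
  exact YoungDiagram.notMem_bot (i, 0) (YoungDiagram.mem_iff_lt_rowLen.2 (Nat.pos_of_ne_zero h))

theorem le_iff_rowLen {μ ν : YoungDiagram} : μ ≤ ν ↔ ∀ i, μ.rowLen i ≤ ν.rowLen i := by
  constructor
  · intro h i
    by_contra! hlt
    have := YoungDiagram.mem_iff_lt_rowLen.2 hlt
    exact lt_irrefl _ (YoungDiagram.mem_iff_lt_rowLen.1 (h this))
  · rintro h ⟨i, j⟩ hc
    exact YoungDiagram.mem_iff_lt_rowLen.2 ((YoungDiagram.mem_iff_lt_rowLen.1 hc).trans_le (h i))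

theorem rowLen_card_eq_zero (μ : YoungDiagram) : μ.rowLen μ.card = 0 := by
  by_contra h
  have hsub : (Finset.range (μ.card + 1)).map ⟨fun i => (i, 0), fun a b h => by simpa using h⟩ ⊆
      μ.cells := by
    intro c hc
    obtain ⟨i, hi, rfl⟩ := Finset.mem_map.1 hc
    rw [Finset.mem_range] at hi
    refine (YoungDiagram.mem_cells _).2 (YoungDiagram.mem_iff_lt_rowLen.2 ?_)
    exact (Nat.pos_of_ne_zero h).trans_le (μ.rowLen_anti _ _ (by omega))
  have := Finset.card_le_card hsub
  simp at this

theorem rowLen_eq_zero_of_le {μ : YoungDiagram} {m n : ℕ} (h : μ.rowLen m = 0) (hmn : m ≤ n) :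
    μ.rowLen n = 0 :=
  Nat.le_zero.1 (h ▸ μ.rowLen_anti _ _ hmn)

theorem card_eq_sum_rowLen (μ : YoungDiagram) {n : ℕ} (h : μ.rowLen n = 0) :
    μ.card = ∑ i ∈ Finset.range n, μ.rowLen i := by
  have hmem : ∀ c ∈ μ.cells, c.1 ∈ Finset.range n := by
    rintro ⟨i, j⟩ hc
    rw [Finset.mem_range]
    by_contra! hle
    have := YoungDiagram.mem_iff_lt_rowLen.1 ((YoungDiagram.mem_cells _).1 hc)
    rw [rowLen_eq_zero_of_le h hle] at this
    omega
  rw [YoungDiagram.card, Finset.card_eq_sum_card_fiberwise hmem]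
  exact Finset.sum_congr rfl fun i _ => (μ.rowLen_eq_card).symm

@[simp]
theorem card_bot : (⊥ : YoungDiagram).card = 0 := by
  simp [YoungDiagram.card]

/-- The Young diagram with row lengths `f 0 ≥ f 1 ≥ …`. -/
def ofRowFun (f : ℕ → ℕ) (hf : Antitone f) (h0 : ∃ n, f n = 0) : YoungDiagram where
  cells := (Finset.range (h0.choose) ×ˢ Finset.range (f 0)).filter fun c => c.2 < f c.1
  isLowerSet := by
    rintro ⟨i, j⟩ ⟨i', j'⟩ ⟨hi, hj⟩ h
    simp only [Finset.coe_filter, Finset.mem_product, Finset.mem_range, Set.mem_ofPred_eq] at h ⊢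
    have h1 : i' ≤ i := hi
    have h2 : j' ≤ j := hj
    have := hf h1
    omega

@[simp]
theorem rowLen_ofRowFun (f : ℕ → ℕ) (hf : Antitone f) (h0 : ∃ n, f n = 0) (i : ℕ) :
    (ofRowFun f hf h0).rowLen i = f i := by
  have key : ∀ j, j < (ofRowFun f hf h0).rowLen i ↔ j < f i := by
    intro j
    rw [← YoungDiagram.mem_iff_lt_rowLen, ← YoungDiagram.mem_cells]
    simp only [ofRowFun, Finset.mem_filter, Finset.mem_product, Finset.mem_range]
    refine ⟨fun h => h.2, fun h => ⟨⟨?_, h.trans_le (hf (Nat.zero_le i))⟩, h⟩⟩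
    by_contra! hle
    have := hf hle
    have := h0.choose_spec
    omega
  exact le_antisymm (le_of_not_gt fun h => lt_irrefl _ ((key _).1 h))
    (le_of_not_gt fun h => lt_irrefl _ ((key _).2 h))

/-! ### Horizontal strips -/

/-- `HStrip μ ν` says that `ν / μ` is a horizontal strip: the row lengths interlace,
`ν_1 ≥ μ_1 ≥ ν_2 ≥ μ_2 ≥ …`. -/
def HStrip (μ ν : YoungDiagram) : Prop :=
  ∀ i, μ.rowLen i ≤ ν.rowLen i ∧ ν.rowLen (i + 1) ≤ μ.rowLen i

theorem HStrip.le {μ ν : YoungDiagram} (h : HStrip μ ν) : μ ≤ ν :=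
  le_iff_rowLen.2 fun i => (h i).1

theorem HStrip.card_le {μ ν : YoungDiagram} (h : HStrip μ ν) : μ.card ≤ ν.card :=
  Finset.card_le_card (YoungDiagram.cells_subset_iff.2 h.le)

theorem HStrip.refl (μ : YoungDiagram) : HStrip μ μ :=
  fun i => ⟨le_rfl, μ.rowLen_anti _ _ (Nat.le_succ i)⟩

theorem HStrip.eq_bot {μ : YoungDiagram} (h : HStrip μ ⊥) : μ = ⊥ :=
  le_bot_iff.1 h.le

/-! ### Transfer kernels -/

/-- A kernel with values in `[0, ∞]` on the set of Young diagrams, viewed as an infinite matrix.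
With these values every sum over intermediate diagrams makes sense. -/
def Transfer : Type := YoungDiagram → YoungDiagram → ℝ≥0∞

namespace Transfer

@[ext]
theorem ext {K M : Transfer} (h : ∀ μ ν, K μ ν = M μ ν) : K = M :=
  funext fun μ => funext fun ν => h μ ν

open Classical in
/-- Transfer kernels form a monoid under matrix multiplication. -/
instance : Monoid Transfer where
  mul K M := fun μ ν => ∑' ρ, K μ ρ * M ρ ν
  one := fun μ ν => if μ = ν then 1 else 0
  one_mul K := by
    funext μ ν
    change ∑' ρ, (if μ = ρ then 1 else 0) * K ρ ν = K μ ν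
    rw [tsum_eq_single μ (fun ρ h => by rw [if_neg (Ne.symm h), zero_mul])]
    simp
  mul_one K := by
    funext μ ν
    change ∑' ρ, K μ ρ * (if ρ = ν then 1 else 0) = K μ ν
    rw [tsum_eq_single ν (fun ρ h => by rw [if_neg h, mul_zero])]
    simp
  mul_assoc K M N := by
    funext μ ν
    change ∑' ρ, (∑' σ, K μ σ * M σ ρ) * N ρ ν = ∑' σ, K μ σ * ∑' ρ, M σ ρ * N ρ ν
    simp_rw [← ENNReal.tsum_mul_right, ← ENNReal.tsum_mul_left]
    rw [ENNReal.tsum_comm]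
    simp_rw [mul_assoc]

theorem mul_apply (K M : Transfer) (μ ν : YoungDiagram) : (K * M) μ ν = ∑' ρ, K μ ρ * M ρ ν := rfl

open Classical in
theorem one_apply (μ ν : YoungDiagram) : (1 : Transfer) μ ν = if μ = ν then 1 else 0 := by
  change (if μ = ν then (1 : ℝ≥0∞) else 0) = _
  congr

/-- The multiple of a kernel by a constant. -/
def scale (c : ℝ≥0∞) (K : Transfer) : Transfer := fun μ ν => c * K μ ν

theorem scale_apply (c : ℝ≥0∞) (K : Transfer) (μ ν : YoungDiagram) : scale c K μ ν = c * K μ ν :=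
  rfl

theorem scale_mul (c : ℝ≥0∞) (K M : Transfer) : scale c K * M = scale c (K * M) := by
  ext μ ν
  simp_rw [mul_apply, scale_apply, mul_apply, mul_assoc, ENNReal.tsum_mul_left]

theorem mul_scale (c : ℝ≥0∞) (K M : Transfer) : K * scale c M = scale c (K * M) := by
  ext μ ν
  simp_rw [mul_apply, scale_apply, mul_apply, mul_left_comm _ c, ENNReal.tsum_mul_left]

theorem scale_scale (c d : ℝ≥0∞) (K : Transfer) : scale c (scale d K) = scale (c * d) K := by
  ext μ ν
  simp_rw [scale_apply, mul_assoc]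

open Classical in
/-- Adding a horizontal strip `ν / μ`, with weight `x` per box. -/
def up (x : ℝ≥0∞) : Transfer := fun μ ν => if HStrip μ ν then x ^ (ν.card - μ.card) else 0

/-- Removing a horizontal strip `μ / ν`, with weight `y` per box. -/
def down (y : ℝ≥0∞) : Transfer := fun μ ν => up y ν μ

theorem up_of_hStrip {x : ℝ≥0∞} {μ ν : YoungDiagram} (h : HStrip μ ν) :
    up x μ ν = x ^ (ν.card - μ.card) := if_pos h

theorem up_of_not_hStrip {x : ℝ≥0∞} {μ ν : YoungDiagram} (h : ¬ HStrip μ ν) :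
    up x μ ν = 0 := if_neg h

/-- Reindexing a sum over `ℝ≥0∞` by a bijection between sets that contain the supports. -/
theorem _root_.ENNReal.tsum_eq_tsum_of_equiv {α β : Type*} {f : α → ℝ≥0∞} {g : β → ℝ≥0∞}
    {p : α → Prop} {r : β → Prop} (e : {a // p a} ≃ {b // r b}) (hf : ∀ a, ¬ p a → f a = 0)
    (hg : ∀ b, ¬ r b → g b = 0) (h : ∀ a, f a.1 = g (e a).1) : ∑' a, f a = ∑' b, g b := by
  have h1 : ∑' a : {a // p a}, f a = ∑' a, f a :=
    tsum_subtype_eq_of_support_subset (s := {a | p a}) fun a ha => by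
      by_contra hn
      exact ha (hf a hn)
  have h2 : ∑' b : {b // r b}, g b = ∑' b, g b :=
    tsum_subtype_eq_of_support_subset (s := {b | r b}) fun b hb => by
      by_contra hn
      exact hb (hg b hn)
  rw [← h1, ← h2, ← e.tsum_eq]
  exact tsum_congr h

end Transfer

/-! ### Commutation of two upward steps -/

/-- The lower bound for row `i` of a diagram between `μ` and `lam` (both steps being horizontal
strips). -/
def loBetween (μ lam : YoungDiagram) (i : ℕ) : ℕ := max (μ.rowLen i) (lam.rowLen (i + 1))

/-- The upper bound for row `i` of a diagram between `μ` and `lam` (both steps being horizontal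
strips). -/
def hiBetween (μ lam : YoungDiagram) : ℕ → ℕ
  | 0 => lam.rowLen 0
  | i + 1 => min (lam.rowLen (i + 1)) (μ.rowLen i)

theorem between_iff {μ ρ lam : YoungDiagram} : (HStrip μ ρ ∧ HStrip ρ lam) ↔
    ∀ i, loBetween μ lam i ≤ ρ.rowLen i ∧ ρ.rowLen i ≤ hiBetween μ lam i := by
  constructor
  · rintro ⟨h1, h2⟩ i
    have a := h1 i
    have b := h2 i
    refine ⟨max_le a.1 b.2, ?_⟩
    cases i with
    | zero => exact b.1
    | succ i => exact le_min b.1 (h1 i).2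
  · intro h
    refine ⟨fun i => ⟨(le_max_left _ _).trans (h i).1, (h (i + 1)).2.trans (min_le_right _ _)⟩,
      fun i => ⟨(h i).2.trans ?_, (le_max_right _ _).trans (h i).1⟩⟩
    cases i with
    | zero => exact le_rfl
    | succ i => exact min_le_left _ _

theorem hiBetween_succ_le (μ lam : YoungDiagram) (i : ℕ) :
    hiBetween μ lam (i + 1) ≤ loBetween μ lam i :=
  (min_le_left _ _).trans (le_max_right _ _)

/-- The Bender–Knuth reflection: each row length of a diagram between `μ` and `lam` is reflected in
the interval of values open to it. -/
def reflectBetween {μ lam : YoungDiagram} (ρ : {ρ // HStrip μ ρ ∧ HStrip ρ lam}) :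
    {ρ // HStrip μ ρ ∧ HStrip ρ lam} := by
  have hb := between_iff.1 ρ.2
  refine ⟨ofRowFun (fun i => loBetween μ lam i + hiBetween μ lam i - ρ.1.rowLen i) ?_ ?_, ?_⟩
  · refine antitone_nat_of_succ_le fun i => ?_
    have h1 := hb i
    have h2 := hb (i + 1)
    have h3 := hiBetween_succ_le μ lam i
    omega
  · refine ⟨lam.card + 1, ?_⟩
    have h1 := hb (lam.card + 1)
    have h2 : hiBetween μ lam (lam.card + 1) ≤ lam.rowLen (lam.card + 1) := min_le_left _ _
    have h3 := rowLen_eq_zero_of_le (rowLen_card_eq_zero lam) (Nat.le_succ _)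
    simp only [Nat.succ_eq_add_one] at *
    omega
  · refine between_iff.2 fun i => ?_
    rw [rowLen_ofRowFun]
    have h1 := hb i
    omega

theorem rowLen_reflectBetween {μ lam : YoungDiagram} (ρ : {ρ // HStrip μ ρ ∧ HStrip ρ lam})
    (i : ℕ) : (reflectBetween ρ).1.rowLen i =
      loBetween μ lam i + hiBetween μ lam i - ρ.1.rowLen i := by
  simp [reflectBetween]

theorem card_reflectBetween {μ lam : YoungDiagram} (ρ : {ρ // HStrip μ ρ ∧ HStrip ρ lam}) :
    (reflectBetween ρ).1.card + ρ.1.card = lam.card + μ.card := by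
  set n := lam.card + 1 with hn
  have hlam : ∀ i, lam.card ≤ i → lam.rowLen i = 0 := fun i hi =>
    rowLen_eq_zero_of_le (rowLen_card_eq_zero lam) hi
  have h1 : ∀ κ, κ ≤ lam → κ.rowLen n = 0 := fun κ hκ =>
    Nat.le_zero.1 ((le_iff_rowLen.1 hκ n).trans (hlam n (by omega)).le)
  have hb := between_iff.1 ρ.2
  rw [card_eq_sum_rowLen _ (h1 _ (reflectBetween ρ).2.2.le),
    card_eq_sum_rowLen _ (h1 _ ρ.2.2.le), card_eq_sum_rowLen _ (h1 _ le_rfl),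
    card_eq_sum_rowLen _ (h1 _ (ρ.2.1.le.trans ρ.2.2.le)), ← Finset.sum_add_distrib]
  have h2 : ∀ i ∈ Finset.range n, (reflectBetween ρ).1.rowLen i + ρ.1.rowLen i =
      loBetween μ lam i + hiBetween μ lam i := by
    intro i _
    rw [rowLen_reflectBetween]
    have := hb i
    omega
  rw [Finset.sum_congr rfl h2, Finset.sum_add_distrib, hn, Finset.sum_range_succ' (hiBetween μ lam),
    Finset.sum_range_succ (loBetween μ lam), Finset.sum_range_succ' lam.rowLen,
    Finset.sum_range_succ μ.rowLen]
  -- The minimum and the maximum of `μ_i` and `lam_{i+1}` add up to `μ_i + lam_{i+1}`.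
  have h3 : ∀ i ∈ Finset.range lam.card, loBetween μ lam i + hiBetween μ lam (i + 1) =
      lam.rowLen (i + 1) + μ.rowLen i := by
    intro i _
    simp only [loBetween, hiBetween]
    omega
  have h4 := Finset.sum_congr rfl h3
  rw [Finset.sum_add_distrib, Finset.sum_add_distrib] at h4
  have h5 : loBetween μ lam lam.card = μ.rowLen lam.card := by
    simp [loBetween, hlam]
  have h6 : hiBetween μ lam 0 = lam.rowLen 0 := rfl
  omega

/-- Upward steps commute: the symmetry of (skew) Schur functions in two adjacent variables. -/
theorem Transfer.up_commute (x y : ℝ≥0∞) : Commute (Transfer.up x) (Transfer.up y) := by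
  ext μ lam
  rw [Transfer.mul_apply, Transfer.mul_apply]
  have hz : ∀ z w : ℝ≥0∞, ∀ ρ, ¬ (HStrip μ ρ ∧ HStrip ρ lam) → up z μ ρ * up w ρ lam = 0 := by
    intro z w ρ h
    by_cases h1 : HStrip μ ρ
    · rw [up_of_not_hStrip fun h2 => h ⟨h1, h2⟩, mul_zero]
    · rw [up_of_not_hStrip h1, zero_mul]
  have hinv : Function.Involutive (reflectBetween (μ := μ) (lam := lam)) := by
    intro ρ
    refine Subtype.ext (ext_rowLen fun i => ?_)
    rw [rowLen_reflectBetween, rowLen_reflectBetween]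
    have := between_iff.1 ρ.2 i
    omega
  refine ENNReal.tsum_eq_tsum_of_equiv (hinv.toPerm _) (hz x y) (hz y x) fun ρ => ?_
  have h1 := ρ.2
  have h2 := (reflectBetween ρ).2
  have h3 := card_reflectBetween ρ
  change _ = up y μ (reflectBetween ρ).1 * up x (reflectBetween ρ).1 lam
  rw [up_of_hStrip h1.1, up_of_hStrip h1.2, up_of_hStrip h2.1, up_of_hStrip h2.2, mul_comm]
  have := h1.1.card_le
  have := h1.2.card_le
  have := h2.1.card_le
  have := h2.2.card_le
  congr 2 <;> omega

/-! ### Commutation of an upward and a downward step -/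

/-- The row lengths of the diagram above both `μ` and `lam` that corresponds to the diagram `κ`
below both and the number `n`. -/
def aboveRow (μ lam κ : YoungDiagram) (n : ℕ) : ℕ → ℕ
  | 0 => max (μ.rowLen 0) (lam.rowLen 0) + n
  | i + 1 => max (μ.rowLen (i + 1)) (lam.rowLen (i + 1)) + min (μ.rowLen i) (lam.rowLen i) -
      κ.rowLen i

/-- The local Robinson–Schensted–Knuth bijection: a diagram `ν` above `μ` and `lam` (by horizontal
strips) corresponds to a number, the excess of `ν_1`, and a diagram below `μ` and `lam`, whose
`i`-th row is the reflection of `ν_{i+1}` in the interval of values open to both. -/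
def aboveEquivBelow (μ lam : YoungDiagram) : {ν // HStrip μ ν ∧ HStrip lam ν} ≃
    {p : ℕ × YoungDiagram // HStrip p.2 μ ∧ HStrip p.2 lam} where
  toFun ν := by
    refine ⟨(ν.1.rowLen 0 - max (μ.rowLen 0) (lam.rowLen 0), ofRowFun (fun i =>
      max (μ.rowLen (i + 1)) (lam.rowLen (i + 1)) + min (μ.rowLen i) (lam.rowLen i) -
      ν.1.rowLen (i + 1)) ?_ ?_), ?_⟩
    · refine antitone_nat_of_succ_le fun i => ?_
      have h1 := ν.2.1 i
      have h2 := ν.2.2 i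
      have h3 := ν.2.1 (i + 1)
      have h4 := ν.2.2 (i + 1)
      have h5 := ν.2.1 (i + 1 + 1)
      have h6 := ν.2.2 (i + 1 + 1)
      omega
    · refine ⟨μ.card + lam.card, ?_⟩
      have h1 := rowLen_eq_zero_of_le (rowLen_card_eq_zero μ) (Nat.le_add_right _ lam.card)
      have h2 := rowLen_eq_zero_of_le (rowLen_card_eq_zero lam) (Nat.le_add_left _ μ.card)
      have h3 := rowLen_eq_zero_of_le h1 (Nat.le_succ _)
      have h4 := rowLen_eq_zero_of_le h2 (Nat.le_succ _)
      simp only [Nat.succ_eq_add_one] at *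
      omega
    · constructor <;> intro i <;> simp only [rowLen_ofRowFun] <;>
      · have h1 := ν.2.1 i
        have h2 := ν.2.2 i
        have h3 := ν.2.1 (i + 1)
        have h4 := ν.2.2 (i + 1)
        omega
  invFun p := by
    refine ⟨ofRowFun (aboveRow μ lam p.1.2 p.1.1) ?_ ?_, ?_⟩
    · refine antitone_nat_of_succ_le fun i => ?_
      have h1 := p.2.1 i
      have h2 := p.2.2 i
      cases i with
      | zero =>
        simp only [aboveRow]
        omega
      | succ i =>
        have h3 := p.2.1 i
        have h4 := p.2.2 i
        simp only [aboveRow]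
        omega
    · refine ⟨μ.card + lam.card + 1, ?_⟩
      have h1 := rowLen_eq_zero_of_le (rowLen_card_eq_zero μ) (Nat.le_add_right _ lam.card)
      have h2 := rowLen_eq_zero_of_le (rowLen_card_eq_zero lam) (Nat.le_add_left _ μ.card)
      have h3 := rowLen_eq_zero_of_le h1 (Nat.le_succ _)
      have h4 := rowLen_eq_zero_of_le h2 (Nat.le_succ _)
      simp only [aboveRow, Nat.succ_eq_add_one] at *
      omega
    · constructor <;> intro i <;> simp only [rowLen_ofRowFun] <;>
      · have h1 := p.2.1 i
        have h2 := p.2.2 i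
        cases i with
        | zero =>
          simp only [aboveRow]
          omega
        | succ i =>
          have h3 := p.2.1 i
          have h4 := p.2.2 i
          simp only [aboveRow]
          omega
  left_inv ν := by
    refine Subtype.ext (ext_rowLen fun i => ?_)
    cases i with
    | zero =>
      simp only [rowLen_ofRowFun, aboveRow]
      have h1 := ν.2.1 0
      have h2 := ν.2.2 0
      omega
    | succ i =>
      simp only [rowLen_ofRowFun, aboveRow]
      have h1 := ν.2.1 i
      have h2 := ν.2.2 i
      have h3 := ν.2.1 (i + 1)
      have h4 := ν.2.2 (i + 1)
      omega
  right_inv p := by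
    refine Subtype.ext (Prod.ext ?_ (ext_rowLen fun i => ?_))
    · simp only [rowLen_ofRowFun, aboveRow]
      omega
    · simp only [rowLen_ofRowFun, aboveRow]
      have h1 := p.2.1 i
      have h2 := p.2.2 i
      omega

theorem card_aboveEquivBelow (μ lam : YoungDiagram) (ν : {ν // HStrip μ ν ∧ HStrip lam ν}) :
    ν.1.card + (aboveEquivBelow μ lam ν).1.2.card =
      (aboveEquivBelow μ lam ν).1.1 + μ.card + lam.card := by
  set n := μ.card + lam.card with hn
  have hμ : μ.rowLen n = 0 :=
    rowLen_eq_zero_of_le (rowLen_card_eq_zero μ) (Nat.le_add_right _ _)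
  have hl : lam.rowLen n = 0 :=
    rowLen_eq_zero_of_le (rowLen_card_eq_zero lam) (Nat.le_add_left _ _)
  have hν : ν.1.rowLen (n + 1) = 0 := Nat.le_zero.1 (hμ ▸ (ν.2.1 n).2)
  have hκ : (aboveEquivBelow μ lam ν).1.2.rowLen n = 0 :=
    Nat.le_zero.1 (hμ ▸ ((aboveEquivBelow μ lam ν).2.1 n).1)
  have hμ' := rowLen_eq_zero_of_le hμ (Nat.le_succ _)
  have hl' := rowLen_eq_zero_of_le hl (Nat.le_succ _)
  have e0 : ν.1.rowLen 0 = (aboveEquivBelow μ lam ν).1.1 + max (μ.rowLen 0) (lam.rowLen 0) := by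
    have h1 := (ν.2.1 0).1
    have h2 := (ν.2.2 0).1
    change _ = ν.1.rowLen 0 - max (μ.rowLen 0) (lam.rowLen 0) + _
    omega
  have e1 : ∀ i, ν.1.rowLen (i + 1) + (aboveEquivBelow μ lam ν).1.2.rowLen i =
      max (μ.rowLen (i + 1)) (lam.rowLen (i + 1)) + min (μ.rowLen i) (lam.rowLen i) := by
    intro i
    have h : (aboveEquivBelow μ lam ν).1.2.rowLen i = max (μ.rowLen (i + 1)) (lam.rowLen (i + 1)) +
      min (μ.rowLen i) (lam.rowLen i) - ν.1.rowLen (i + 1) := by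
      simp [aboveEquivBelow]
    rw [h]
    have h1 := ν.2.1 i
    have h2 := ν.2.2 i
    have h3 := ν.2.1 (i + 1)
    have h4 := ν.2.2 (i + 1)
    omega
  have e2 := Finset.sum_congr (s₁ := Finset.range n) rfl fun i _ => e1 i
  have e3 : ∑ i ∈ Finset.range (n + 1), max (μ.rowLen i) (lam.rowLen i) +
      ∑ i ∈ Finset.range (n + 1), min (μ.rowLen i) (lam.rowLen i) =
      ∑ i ∈ Finset.range (n + 1), μ.rowLen i + ∑ i ∈ Finset.range (n + 1), lam.rowLen i := by
    rw [← Finset.sum_add_distrib, ← Finset.sum_add_distrib]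
    exact Finset.sum_congr rfl fun i _ => max_add_min _ _
  rw [card_eq_sum_rowLen _ hν, card_eq_sum_rowLen _ hκ, card_eq_sum_rowLen _ hμ',
    card_eq_sum_rowLen _ hl', Finset.sum_range_succ']
  rw [Finset.sum_add_distrib, Finset.sum_add_distrib] at e2
  rw [Finset.sum_range_succ' (fun i => max (μ.rowLen i) (lam.rowLen i)),
    Finset.sum_range_succ (fun i => min (μ.rowLen i) (lam.rowLen i)), hμ, hl] at e3
  simp only [Nat.succ_eq_add_one, min_self] at *
  omega

/-- An upward step moves past a downward step at the price of a geometric series: the skew Cauchy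
identity in one plus one variable. Since the values lie in `[0, ∞]`, nothing is said about
convergence. -/
theorem Transfer.up_mul_down (x y : ℝ≥0∞) : Transfer.up x * Transfer.down y =
    Transfer.scale (∑' n : ℕ, (x * y) ^ n) (Transfer.down y * Transfer.up x) := by
  ext μ lam
  rw [scale_apply, mul_apply, mul_apply, ← ENNReal.tsum_mul_right]
  simp_rw [← ENNReal.tsum_mul_left]
  rw [← ENNReal.tsum_prod (f := fun n κ => (x * y) ^ n * (down y μ κ * up x κ lam))]
  refine ENNReal.tsum_eq_tsum_of_equiv (aboveEquivBelow μ lam) (fun ν h => ?_) (fun p h => ?_)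
    fun ν => ?_
  · by_cases h1 : HStrip μ ν
    · rw [down, up_of_not_hStrip (ν := ν) (μ := lam) fun h2 => h ⟨h1, h2⟩, mul_zero]
    · rw [up_of_not_hStrip h1, zero_mul]
  · by_cases h1 : HStrip p.2 μ
    · rw [up_of_not_hStrip (ν := lam) (μ := p.2) fun h2 => h ⟨h1, h2⟩, mul_zero, mul_zero]
    · rw [down, up_of_not_hStrip h1, zero_mul, mul_zero]
  · have h1 := ν.2
    have h2 := (aboveEquivBelow μ lam ν).2
    have h3 := card_aboveEquivBelow μ lam ν
    have e1 := h1.1.card_le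
    have e2 := h1.2.card_le
    have e3 := h2.1.card_le
    have e4 := h2.2.card_le
    rw [down, down, up_of_hStrip h1.1, up_of_hStrip h1.2, up_of_hStrip h2.1, up_of_hStrip h2.2]
    generalize (aboveEquivBelow μ lam ν).1 = p at *
    have e5 : ν.1.card - μ.card = p.1 + (lam.card - p.2.card) := by omega
    have e6 : ν.1.card - lam.card = p.1 + (μ.card - p.2.card) := by omega
    rw [e5, e6]
    ring

/-! ### Schur functions as products of upward steps -/

open Classical in
/-- The generating function over `[0, ∞]` of semistandard tableaux of shape `lam / μ`. -/
def tableauSum (lam μ : YoungDiagram) {n : ℕ} (x : Fin n → ℝ≥0∞) : ℝ≥0∞ :=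
  ∑' T : skewCells lam μ → Fin n, if μ ≤ lam ∧ IsSemistandard T then ∏ c, x (T c) else 0

theorem ofReal_skewSchur (lam μ : YoungDiagram) (xs : List ℝ) (hxs : ∀ x ∈ xs, 0 ≤ x) :
    ENNReal.ofReal (skewSchur lam μ xs) =
      tableauSum lam μ fun i : Fin xs.length => ENNReal.ofReal (xs.get i) := by
  classical
  have h0 : ∀ i : Fin xs.length, 0 ≤ xs.get i := fun i => hxs _ (xs.get_mem i)
  rw [skewSchur, tableauSum, tsum_fintype]
  split_ifs with h
  · rw [ENNReal.ofReal_sum_of_nonneg fun T _ => Finset.prod_nonneg fun c _ => h0 _,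
      Finset.sum_filter]
    refine Finset.sum_congr rfl fun T _ => ?_
    rw [ENNReal.ofReal_prod_of_nonneg fun c _ => h0 _]
    simp [h]
  · simp [h]

theorem skewSchur_nonneg (lam μ : YoungDiagram) (xs : List ℝ) (hxs : ∀ x ∈ xs, 0 ≤ x) :
    0 ≤ skewSchur lam μ xs := by
  rw [skewSchur]
  split_ifs
  · exact Finset.sum_nonneg fun T _ => Finset.prod_nonneg fun c _ => hxs _ (xs.get_mem _)
  · exact le_rfl

theorem mem_skewCells {lam μ : YoungDiagram} {c : ℕ × ℕ} :
    c ∈ skewCells lam μ ↔ c ∈ lam ∧ c ∉ μ := by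
  simp [skewCells]

theorem card_skewCells {lam μ : YoungDiagram} (h : μ ≤ lam) :
    (skewCells lam μ).card = lam.card - μ.card :=
  Finset.card_sdiff_of_subset (YoungDiagram.cells_subset_iff.2 h)

theorem hStrip_iff_mem {μ ν : YoungDiagram} :
    HStrip μ ν ↔ μ ≤ ν ∧ ∀ i j, (i + 1, j) ∈ ν → (i, j) ∈ μ := by
  constructor
  · intro h
    refine ⟨h.le, fun i j hc => ?_⟩
    exact YoungDiagram.mem_iff_lt_rowLen.2 ((YoungDiagram.mem_iff_lt_rowLen.1 hc).trans_le (h i).2)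
  · rintro ⟨h1, h2⟩ i
    refine ⟨le_iff_rowLen.1 h1 i, ?_⟩
    by_contra! hlt
    exact lt_irrefl _ (YoungDiagram.mem_iff_lt_rowLen.1
      (h2 _ _ (YoungDiagram.mem_iff_lt_rowLen.2 hlt)))

theorem IsSemistandard.mono {lam μ : YoungDiagram} {n : ℕ} {T : skewCells lam μ → Fin n}
    (hT : IsSemistandard T) {c d : skewCells lam μ} (h1 : c.1.1 ≤ d.1.1) (h2 : c.1.2 ≤ d.1.2) :
    T c ≤ T d := by
  have hc := mem_skewCells.1 c.2
  have hd := mem_skewCells.1 d.2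
  have he : (d.1.1, c.1.2) ∈ skewCells lam μ := mem_skewCells.2
    ⟨lam.up_left_mem le_rfl h2 hd.1, fun h => hc.2 (μ.up_left_mem h1 le_rfl h)⟩
  have hce : T c ≤ T ⟨_, he⟩ := by
    rcases h1.eq_or_lt with h | h
    · exact le_of_eq (congrArg T (Subtype.ext (Prod.ext h rfl)))
    · exact (hT.2 c ⟨_, he⟩ rfl h).le
  refine hce.trans ?_
  rcases h2.eq_or_lt with h | h
  · exact le_of_eq (congrArg T (Subtype.ext (Prod.ext rfl h)))
  · exact hT.1 ⟨_, he⟩ d rfl h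

/-- `ν / μ` is the set of boxes of the tableau `T` of shape `lam / μ` that contain the smallest
possible entry. -/
def IsZeroShape {lam μ : YoungDiagram} {n : ℕ} (T : skewCells lam μ → Fin (n + 1))
    (ν : YoungDiagram) : Prop :=
  μ ≤ ν ∧ ν ≤ lam ∧ ∀ c, T c = 0 ↔ c.1 ∈ ν

theorem exists_isZeroShape {lam μ : YoungDiagram} (h : μ ≤ lam) {n : ℕ}
    {T : skewCells lam μ → Fin (n + 1)} (hT : IsSemistandard T) : ∃ ν, IsZeroShape T ν := by
  classical
  let s : Finset (ℕ × ℕ) := lam.cells.filter fun c => ∀ hc : c ∈ skewCells lam μ, T ⟨c, hc⟩ = 0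
  have hs : IsLowerSet (s : Set (ℕ × ℕ)) := by
    rintro ⟨i, j⟩ ⟨i', j'⟩ hle hc
    simp only [s, Finset.coe_filter, Set.mem_ofPred_eq, YoungDiagram.mem_cells] at hc ⊢
    have hl := lam.up_left_mem (Prod.mk_le_mk.1 hle).1 (Prod.mk_le_mk.1 hle).2 hc.1
    refine ⟨hl, fun hc' => ?_⟩
    have hm : (i, j) ∈ skewCells lam μ := mem_skewCells.2 ⟨hc.1, fun hm => (mem_skewCells.1 hc').2
      (μ.up_left_mem (Prod.mk_le_mk.1 hle).1 (Prod.mk_le_mk.1 hle).2 hm)⟩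
    have := hT.mono (c := ⟨_, hc'⟩) (d := ⟨_, hm⟩) (Prod.mk_le_mk.1 hle).1 (Prod.mk_le_mk.1 hle).2
    rw [hc.2 hm] at this
    exact Fin.le_zero_iff.1 this
  refine ⟨⟨s, hs⟩, fun c hc => ?_, fun c hc => ?_, fun c => ?_⟩
  · change c ∈ s
    exact Finset.mem_filter.2 ⟨h hc, fun hc' => absurd hc (mem_skewCells.1 hc').2⟩
  · exact (Finset.mem_filter.1 (show c ∈ s from hc)).1
  · change _ ↔ c.1 ∈ s
    rw [Finset.mem_filter]
    exact ⟨fun h0 => ⟨(mem_skewCells.1 c.2).1, fun _ => h0⟩, fun h0 => h0.2 c.2⟩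

theorem IsZeroShape.unique {lam μ ν ρ : YoungDiagram} {n : ℕ} {T : skewCells lam μ → Fin (n + 1)}
    (h1 : IsZeroShape T ν) (h2 : IsZeroShape T ρ) : ν = ρ := by
  have key : ∀ {ν ρ : YoungDiagram}, IsZeroShape T ν → IsZeroShape T ρ → ν ≤ ρ := by
    intro ν ρ h1 h2 c hc
    by_cases hm : c ∈ μ
    · exact h2.1 hm
    · have hs : c ∈ skewCells lam μ := mem_skewCells.2 ⟨h1.2.1 hc, hm⟩
      exact (h2.2.2 ⟨c, hs⟩).1 ((h1.2.2 ⟨c, hs⟩).2 hc)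
  exact le_antisymm (key h1 h2) (key h2 h1)

theorem IsZeroShape.hStrip {lam μ ν : YoungDiagram} {n : ℕ} {T : skewCells lam μ → Fin (n + 1)}
    (hT : IsSemistandard T) (h : IsZeroShape T ν) : HStrip μ ν := by
  refine hStrip_iff_mem.2 ⟨h.1, fun i j hc => ?_⟩
  by_contra hm
  have hs : (i, j) ∈ skewCells lam μ :=
    mem_skewCells.2 ⟨h.2.1 (ν.up_left_mem (Nat.le_succ i) le_rfl hc), hm⟩
  have hs' : (i + 1, j) ∈ skewCells lam μ := mem_skewCells.2
    ⟨h.2.1 hc, fun h' => hm (μ.up_left_mem (Nat.le_succ i) le_rfl h')⟩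
  have hlt := hT.2 ⟨_, hs⟩ ⟨_, hs'⟩ rfl (Nat.lt_succ_self i)
  rw [(h.2.2 ⟨_, hs'⟩).2 hc] at hlt
  exact Fin.not_lt_zero _ hlt

theorem mem_skewCells_of_le {lam μ ν : YoungDiagram} (h : μ ≤ ν) {c : ℕ × ℕ}
    (hc : c ∈ skewCells lam ν) : c ∈ skewCells lam μ :=
  mem_skewCells.2 ⟨(mem_skewCells.1 hc).1, fun hm => (mem_skewCells.1 hc).2 (h hm)⟩

open Classical in
/-- Removing the boxes with the smallest entry from a tableau, and lowering the other entries. -/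
def peelEquiv {lam μ ν : YoungDiagram} (hμν : HStrip μ ν) (hν : ν ≤ lam) (n : ℕ) :
    {T : skewCells lam μ → Fin (n + 1) // IsSemistandard T ∧ IsZeroShape T ν} ≃
      {T : skewCells lam ν → Fin n // IsSemistandard T} where
  toFun T := ⟨fun c => (T.1 ⟨c.1, mem_skewCells_of_le hμν.le c.2⟩).pred
      (fun h => (mem_skewCells.1 c.2).2 ((T.2.2.2.2 _).1 h)),
    fun c d h1 h2 => Fin.pred_le_pred_iff.2 (T.2.1.1 ⟨c.1, _⟩ ⟨d.1, _⟩ h1 h2),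
    fun c d h1 h2 => Fin.pred_lt_pred_iff.2 (T.2.1.2 ⟨c.1, _⟩ ⟨d.1, _⟩ h1 h2)⟩
  invFun T := ⟨fun c => if h : c.1 ∈ ν then 0 else
      (T.1 ⟨c.1, mem_skewCells.2 ⟨(mem_skewCells.1 c.2).1, h⟩⟩).succ, by
    refine ⟨⟨fun c d h1 h2 => ?_, fun c d h1 h2 => ?_⟩, hμν.le, hν, fun c => ?_⟩
    · by_cases hc : c.1 ∈ ν
      · beta_reduce
        rw [dif_pos hc]
        exact Fin.zero_le _
      · have hd : d.1 ∉ ν := fun hd => hc (ν.up_left_mem h1.le h2.le hd)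
        beta_reduce
        rw [dif_neg hc, dif_neg hd]
        exact Fin.succ_le_succ_iff.2 (T.2.1 ⟨c.1, _⟩ ⟨d.1, _⟩ h1 h2)
    · -- Two boxes of a column cannot both lie in the horizontal strip `ν / μ`.
      have hd : d.1 ∉ ν := by
        intro hd
        have hd' : (d.1.1 - 1 + 1, d.1.2) ∈ ν := by
          rw [Nat.sub_add_cancel (by omega)]
          exact hd
        exact (mem_skewCells.1 c.2).2 (μ.up_left_mem (Nat.le_sub_one_of_lt h2) h1.le
          ((hStrip_iff_mem.1 hμν).2 _ _ hd'))
      beta_reduce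
      rw [dif_neg hd]
      by_cases hc : c.1 ∈ ν
      · rw [dif_pos hc]
        exact Fin.succ_pos _
      · rw [dif_neg hc]
        exact Fin.succ_lt_succ_iff.2 (T.2.2 ⟨c.1, _⟩ ⟨d.1, _⟩ h1 h2)
    · by_cases hc : c.1 ∈ ν
      · simp [hc]
      · simp [hc, Fin.succ_ne_zero]⟩
  left_inv T := by
    refine Subtype.ext (funext fun c => ?_)
    by_cases hc : c.1 ∈ ν
    · simp only [dif_pos hc]
      exact ((T.2.2.2.2 c).2 hc).symm
    · simp only [dif_neg hc, Fin.succ_pred]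
  right_inv T := by
    refine Subtype.ext (funext fun c => ?_)
    simp only [dif_neg (mem_skewCells.1 c.2).2, Fin.pred_succ]

theorem prod_peelEquiv {lam μ ν : YoungDiagram} (hμν : HStrip μ ν) (hν : ν ≤ lam) {n : ℕ}
    (x : Fin (n + 1) → ℝ≥0∞)
    (T : {T : skewCells lam μ → Fin (n + 1) // IsSemistandard T ∧ IsZeroShape T ν}) :
    ∏ c, x (T.1 c) =
      x 0 ^ (ν.card - μ.card) * ∏ c, x ((peelEquiv hμν hν n T).1 c).succ := by
  classical
  let g : ℕ × ℕ → ℝ≥0∞ := fun c => if h : c ∈ skewCells lam μ then x (T.1 ⟨c, h⟩) else 1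
  have h1 : ∏ c, x (T.1 c) = ∏ c ∈ skewCells lam μ, g c := by
    rw [← Finset.prod_coe_sort (skewCells lam μ) g]
    exact Finset.prod_congr rfl fun c _ => by simp only [g, dif_pos c.2]
  have h2 : ∏ c, x ((peelEquiv hμν hν n T).1 c).succ = ∏ c ∈ skewCells lam ν, g c := by
    rw [← Finset.prod_coe_sort (skewCells lam ν) g]
    refine Finset.prod_congr rfl fun c _ => ?_
    simp only [g, dif_pos (mem_skewCells_of_le hμν.le c.2), peelEquiv, Equiv.coe_fn_mk,
      Fin.succ_pred]
  have h3 : ∏ c ∈ skewCells ν μ, g c = x 0 ^ (ν.card - μ.card) := by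
    rw [← card_skewCells hμν.le, ← Finset.prod_const]
    refine Finset.prod_congr rfl fun c hc => ?_
    have hc' := mem_skewCells.1 hc
    have hm : c ∈ skewCells lam μ := mem_skewCells.2 ⟨hν hc'.1, hc'.2⟩
    simp only [g, dif_pos hm, (T.2.2.2.2 ⟨c, hm⟩).2 hc'.1]
  have h4 : skewCells lam μ = skewCells ν μ ∪ skewCells lam ν := by
    ext c
    simp only [Finset.mem_union, mem_skewCells]
    have a : c ∈ ν → c ∈ lam := fun h => hν h
    have b : c ∈ μ → c ∈ ν := fun h => hμν.le h
    tauto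
  have h5 : Disjoint (skewCells ν μ) (skewCells lam ν) :=
    Finset.disjoint_left.2 fun c h h' => (mem_skewCells.1 h').2 (mem_skewCells.1 h).1
  rw [h1, h2, h4, Finset.prod_union h5, h3]

/-- Removing the boxes that contain the first variable from all tableaux. -/
theorem tableauSum_succ (lam μ : YoungDiagram) {n : ℕ} (x : Fin (n + 1) → ℝ≥0∞) :
    tableauSum lam μ x =
      ∑' ν, Transfer.up (x 0) μ ν * tableauSum lam ν fun i : Fin n => x i.succ := by
  classical
  have h1 : tableauSum lam μ x = ∑' T : skewCells lam μ → Fin (n + 1), ∑' ν,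
      if IsSemistandard T ∧ IsZeroShape T ν then ∏ c, x (T c) else 0 := by
    refine tsum_congr fun T => ?_
    by_cases h : μ ≤ lam ∧ IsSemistandard T
    · obtain ⟨ν, hν⟩ := exists_isZeroShape h.1 h.2
      rw [if_pos h, tsum_eq_single ν fun ρ hρ => if_neg fun h' => hρ (h'.2.unique hν),
        if_pos ⟨h.2, hν⟩]
    · rw [if_neg h]
      exact (ENNReal.tsum_eq_zero.2 fun ν => if_neg fun h' => h ⟨h'.2.1.trans h'.2.2.1, h'.1⟩).symm
  rw [h1, ENNReal.tsum_comm]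
  refine tsum_congr fun ν => ?_
  by_cases h : HStrip μ ν ∧ ν ≤ lam
  · rw [tableauSum, ← ENNReal.tsum_mul_left]
    refine ENNReal.tsum_eq_tsum_of_equiv (peelEquiv h.1 h.2 n) (fun T hT => if_neg hT)
      (fun T hT => by rw [if_neg fun h' => hT h'.2, mul_zero]) fun T => ?_
    rw [if_pos T.2, if_pos ⟨h.2, (peelEquiv h.1 h.2 n T).2⟩, Transfer.up_of_hStrip h.1,
      prod_peelEquiv h.1 h.2]
  · have hz : ∑' T : skewCells lam μ → Fin (n + 1),
        (if IsSemistandard T ∧ IsZeroShape T ν then ∏ c, x (T c) else 0) = 0 :=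
      ENNReal.tsum_eq_zero.2 fun T => if_neg fun h' => h ⟨h'.2.hStrip h'.1, h'.2.2.1⟩
    rw [hz]
    by_cases h2 : ν ≤ lam
    · rw [Transfer.up_of_not_hStrip fun h3 => h ⟨h3, h2⟩, zero_mul]
    · rw [tableauSum, ENNReal.tsum_eq_zero.2 fun T => if_neg fun h' => h2 h'.1, mul_zero]

theorem tableauSum_zero (lam μ : YoungDiagram) (x : Fin 0 → ℝ≥0∞) :
    tableauSum lam μ x = (1 : Transfer) μ lam := by
  classical
  rw [Transfer.one_apply, tableauSum, tsum_fintype]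
  split_ifs with h
  · subst h
    have he : IsEmpty (skewCells μ μ) := ⟨fun c => (mem_skewCells.1 c.2).2 (mem_skewCells.1 c.2).1⟩
    rw [Fintype.sum_unique, if_pos ⟨le_rfl, fun c => he.elim c, fun c => he.elim c⟩]
    simp
  · refine Finset.sum_eq_zero fun T _ => if_neg fun h' => h (le_antisymm h'.1 fun c hc => ?_)
    by_contra hm
    exact (T ⟨c, mem_skewCells.2 ⟨hc, hm⟩⟩).elim0

theorem tableauSum_eq_prod (lam : YoungDiagram) : ∀ {n : ℕ} (x : Fin n → ℝ≥0∞) (μ : YoungDiagram),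
    tableauSum lam μ x = ((List.ofFn x).map Transfer.up).prod μ lam
  | 0, x, μ => by simpa using tableauSum_zero lam μ x
  | n + 1, x, μ => by
    rw [tableauSum_succ, List.ofFn_succ, List.map_cons, List.prod_cons, Transfer.mul_apply]
    exact tsum_congr fun ν => by rw [tableauSum_eq_prod]

/-- The skew Schur function of `lam / μ` is the matrix element from `μ` to `lam` of the product of
the upward steps with its variables. -/
theorem ofReal_skewSchur_eq_prod (lam μ : YoungDiagram) (xs : List ℝ) (hxs : ∀ x ∈ xs, 0 ≤ x) :
    ENNReal.ofReal (skewSchur lam μ xs) =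
      ((xs.map ENNReal.ofReal).map Transfer.up).prod μ lam := by
  have h : List.ofFn (fun i : Fin xs.length => ENNReal.ofReal (xs.get i)) =
      xs.map ENNReal.ofReal := by
    conv_rhs => rw [← List.ofFn_get xs, List.map_ofFn]
    rfl
  rw [ofReal_skewSchur lam μ xs hxs, tableauSum_eq_prod, h]

theorem Transfer.prod_up_perm {xs ys : List ℝ≥0∞} (h : xs.Perm ys) :
    (xs.map Transfer.up).prod = (ys.map Transfer.up).prod :=
  (h.map _).prod_eq' (List.pairwise_map.2 (List.pairwise_of_forall fun x y => up_commute x y))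

/-! ### Words of upward and downward steps -/

namespace Transfer

/-- A step of a word: upward with weight `x` (`true`), or downward (`false`). -/
def letter (s : Bool × ℝ≥0∞) : Transfer := if s.1 then up s.2 else down s.2

/-- The weights of the upward steps of a word. -/
def upWeights (w : List (Bool × ℝ≥0∞)) : List ℝ≥0∞ := (w.filter fun s => s.1).map Prod.snd

/-- The weights of the downward steps of a word. -/
def downWeights (w : List (Bool × ℝ≥0∞)) : List ℝ≥0∞ := (w.filter fun s => !s.1).map Prod.snd

theorem geom_ne_zero (z : ℝ≥0∞) : ∑' n : ℕ, z ^ n ≠ 0 := fun h => by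
  simpa using ENNReal.tsum_eq_zero.1 h 0

theorem prod_up_mul_down (xs : List ℝ≥0∞) (y : ℝ≥0∞) : ∃ c ≠ 0,
    (xs.map up).prod * down y = scale c (down y * (xs.map up).prod) := by
  induction xs with
  | nil =>
    refine ⟨1, one_ne_zero, ?_⟩
    ext μ ν
    simp [scale_apply]
  | cons x xs ih =>
    obtain ⟨c, hc, h⟩ := ih
    refine ⟨c * _, mul_ne_zero hc (geom_ne_zero (x * y)), ?_⟩
    rw [List.map_cons, List.prod_cons, mul_assoc, h, mul_scale, ← mul_assoc, up_mul_down,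
      scale_mul, scale_scale, mul_assoc]

theorem down_bot (y : ℝ≥0∞) (ν : YoungDiagram) : down y ⊥ ν = (1 : Transfer) ⊥ ν := by
  classical
  rw [one_apply]
  split_ifs with h
  · subst h
    rw [down, up_of_hStrip (HStrip.refl _), Nat.sub_self, pow_zero]
  · exact up_of_not_hStrip fun h' => h h'.eq_bot.symm

/-- Seen from the empty diagram, a word acts as the product of its upward steps, up to a constant:
every downward step is moved to the beginning of the word, where it acts trivially. -/
theorem word_bot_left (w : List (Bool × ℝ≥0∞)) : ∃ c ≠ 0, ∀ ν,
    (w.map letter).prod ⊥ ν = c * ((upWeights w).map up).prod ⊥ ν := by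
  induction w using List.reverseRecOn with
  | nil => exact ⟨1, one_ne_zero, fun ν => by simp [upWeights]⟩
  | append_singleton w s ih =>
    obtain ⟨c, hc, h⟩ := ih
    obtain ⟨b, z⟩ := s
    have e : ∀ K : Transfer, ∀ ν, ((w.map letter).prod * K) ⊥ ν =
        c * (((upWeights w).map up).prod * K) ⊥ ν := by
      intro K ν
      simp_rw [mul_apply, h, ← ENNReal.tsum_mul_left, mul_assoc]
    cases b with
    | true =>
      refine ⟨c, hc, fun ν => ?_⟩
      have h1 : upWeights (w ++ [(true, z)]) = upWeights w ++ [z] := by simp [upWeights]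
      simp only [h1, List.map_append, List.prod_append, List.map_cons, List.map_nil,
        List.prod_cons, List.prod_nil, mul_one]
      exact e _ ν
    | false =>
      obtain ⟨d, hd, h2⟩ := prod_up_mul_down (upWeights w) z
      refine ⟨c * d, mul_ne_zero hc hd, fun ν => ?_⟩
      have h1 : upWeights (w ++ [(false, z)]) = upWeights w := by simp [upWeights]
      have h3 : (down z * ((upWeights w).map up).prod) ⊥ ν = ((upWeights w).map up).prod ⊥ ν := by
        conv_rhs => rw [← one_mul ((upWeights w).map up).prod]
        simp_rw [mul_apply, down_bot]
      simp only [h1, List.map_append, List.prod_append, List.map_cons, List.map_nil,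
        List.prod_cons, List.prod_nil, mul_one]
      rw [show letter (false, z) = down z from rfl, e, h2, scale_apply, h3, mul_assoc]

/-- The transposed matrix. -/
def transpose (K : Transfer) : Transfer := fun μ ν => K ν μ

theorem transpose_mul (K M : Transfer) : transpose (K * M) = transpose M * transpose K := by
  ext μ ν
  exact tsum_congr fun ρ => mul_comm _ _

theorem transpose_one : transpose 1 = 1 := by
  classical
  ext μ ν
  simp_rw [transpose, one_apply, eq_comm]

theorem transpose_prod (l : List Transfer) :
    transpose l.prod = (l.reverse.map transpose).prod := by
  induction l with
  | nil => exact transpose_one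
  | cons K l ih => simp [transpose_mul, ih]

/-- Seen from the empty diagram at its end, a word acts as the product of its downward steps, up to
a constant. The downward steps are written as upward steps from the end to the beginning. -/
theorem word_bot_right (w : List (Bool × ℝ≥0∞)) : ∃ c ≠ 0, ∀ μ,
    (w.map letter).prod μ ⊥ = c * ((downWeights w).map up).prod ⊥ μ := by
  obtain ⟨c, hc, h⟩ := word_bot_left (w.reverse.map fun s => (!s.1, s.2))
  refine ⟨c, hc, fun μ => ?_⟩
  have h1 : (w.map letter).prod μ ⊥ =
      (((w.reverse.map fun s => (!s.1, s.2))).map letter).prod ⊥ μ := by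
    change transpose (w.map letter).prod ⊥ μ = _
    rw [transpose_prod, ← List.map_reverse, List.map_map, List.map_map]
    have : transpose ∘ letter = letter ∘ fun s => (!s.1, s.2) := by
      funext ⟨b, z⟩
      cases b <;> rfl
    rw [this]
  have h2 : (upWeights (w.reverse.map fun s => (!s.1, s.2))).Perm (downWeights w) := by
    have : upWeights (w.reverse.map fun s => (!s.1, s.2)) = (downWeights w).reverse := by
      simp only [upWeights, downWeights, List.filter_map, List.map_map, ← List.map_reverse,
        ← List.filter_reverse]
      rfl
    rw [this]
    exact List.reverse_perm _
  rw [h1, h, prod_up_perm h2]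

end Transfer

open Classical in
/-- A matrix element of a product of kernels is a sum over paths of diagrams. -/
theorem Transfer.prod_range'_apply (M : ℕ → Transfer) (ν : YoungDiagram) : ∀ (n a : ℕ)
    (μ : YoungDiagram), ((List.range' a n).map M).prod μ ν = ∑' s : Fin (n + 1) → YoungDiagram,
      if s 0 = μ ∧ s (Fin.last n) = ν then
        ∏ i : Fin n, M (a + i) (s i.castSucc) (s i.succ) else 0
  | 0, a, μ => by
    rw [tsum_eq_single (fun _ => μ)]
    · simp [one_apply]
    · intro s hs
      refine if_neg fun h => hs (funext fun i => ?_)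
      rw [Fin.fin_one_eq_zero i, h.1]
  | n + 1, a, μ => by
    rw [List.range'_succ, List.map_cons, List.prod_cons, mul_apply]
    simp_rw [prod_range'_apply M ν n (a + 1), ← ENNReal.tsum_mul_left]
    rw [ENNReal.tsum_comm]
    conv_rhs => rw [← (Fin.consEquiv fun _ : Fin (n + 2) => YoungDiagram).tsum_eq,
      ENNReal.tsum_prod']
    rw [tsum_eq_single μ]
    · refine tsum_congr fun t => ?_
      rw [tsum_eq_single (t 0) fun ρ hρ => by rw [if_neg fun h => hρ h.1.symm, mul_zero]]
      have h1 : (Fin.cons μ t : Fin (n + 2) → YoungDiagram) (Fin.last (n + 1)) =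
          t (Fin.last n) := by
        rw [← Fin.succ_last, Fin.cons_succ]
      simp only [Fin.consEquiv_apply, h1, Fin.cons_zero, true_and]
      split_ifs with h
      · rw [Fin.prod_univ_succ]
        congr 1
        refine Finset.prod_congr rfl fun i _ => ?_
        rw [← Fin.succ_castSucc, Fin.cons_succ, Fin.cons_succ, Fin.val_succ,
          Nat.add_right_comm, Nat.add_assoc]
      · rw [mul_zero]
    · intro ρ hρ
      refine ENNReal.tsum_eq_zero.2 fun t => if_neg fun h => hρ ?_
      simpa using h.1

/-! ### The boundary path and the diagonals -/

theorem rowLen_rectangle (A B i : ℕ) : (rectangle A B).rowLen i = if i < A then B else 0 := by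
  have key : ∀ j, j < (rectangle A B).rowLen i ↔ i < A ∧ j < B := by
    intro j
    rw [← YoungDiagram.mem_iff_lt_rowLen, ← YoungDiagram.mem_cells]
    simp [rectangle]
  split_ifs with h
  · exact le_antisymm (le_of_not_gt fun h' => lt_irrefl _ ((key _).1 h').2)
      (le_of_not_gt fun h' => lt_irrefl _ ((key _).2 ⟨h, h'⟩))
  · exact Nat.eq_zero_of_not_pos fun h' => h ((key _).1 h').1

theorem mem_support {A B : ℕ} {π : YoungDiagram} {i j : ℕ} :
    (i, j) ∈ skewCells (rectangle A B) π ↔ i < A ∧ j < B ∧ π.rowLen i ≤ j := by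
  rw [mem_skewCells, YoungDiagram.mem_iff_lt_rowLen, YoungDiagram.mem_iff_lt_rowLen,
    rowLen_rectangle]
  split_ifs with h <;> simp [h]

theorem rowLen_le_of_le_rectangle {A B : ℕ} {π : YoungDiagram} (hπ : π ≤ rectangle A B) (i : ℕ) :
    π.rowLen i ≤ B ∧ (A ≤ i → π.rowLen i = 0) := by
  have := le_iff_rowLen.1 hπ i
  rw [rowLen_rectangle] at this
  split_ifs at this with h <;> omega

theorem exists_startRow (A : ℕ) (π : YoungDiagram) (k : ℕ) : ∃ r, A + π.rowLen r < k + r :=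
  ⟨A + π.rowLen 0 + 1, by
    have := π.rowLen_anti 0 (A + π.rowLen 0 + 1) (Nat.zero_le _)
    omega⟩

/-- The row (counted from the top) of the point number `k` of the boundary path, that is, the row of
the first box of the diagonal `k`. The diagonal consists of the boxes `(i, j)` of the rectangle with
`j + A + 1 = k + i` and `startRow A π k ≤ i`. -/
def startRow (A : ℕ) (π : YoungDiagram) (k : ℕ) : ℕ := Nat.find (exists_startRow A π k)

theorem startRow_le_iff {A : ℕ} {π : YoungDiagram} {k r : ℕ} :
    startRow A π k ≤ r ↔ A + π.rowLen r < k + r := by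
  constructor
  · intro h
    have h1 : A + π.rowLen (startRow A π k) < k + startRow A π k :=
      Nat.find_spec (exists_startRow A π k)
    have := π.rowLen_anti _ _ h
    omega
  · exact fun h => Nat.find_min' _ h

theorem mem_verticalSteps {A : ℕ} {π : YoungDiagram} {k : ℕ} :
    k ∈ verticalSteps A π ↔ ∃ i < A, A + π.rowLen i = k + i := by
  simp only [verticalSteps, Finset.mem_image, Finset.mem_range]
  refine exists_congr fun i => and_congr_right fun h => ?_
  omega

theorem startRow_of_mem {A : ℕ} {π : YoungDiagram} {k : ℕ} (h : k ∈ verticalSteps A π) :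
    startRow A π k = startRow A π (k + 1) + 1 := by
  obtain ⟨i, hi, he⟩ := mem_verticalSteps.1 h
  have h1 : startRow A π (k + 1) = i := by
    refine le_antisymm (startRow_le_iff.2 (by omega)) ?_
    by_contra! hlt
    have h2 : startRow A π (k + 1) ≤ i - 1 := by omega
    have := startRow_le_iff.1 h2
    have := π.rowLen_anti (i - 1) i (Nat.sub_le _ _)
    omega
  rw [h1]
  refine le_antisymm (startRow_le_iff.2 ?_) ?_
  · have := π.rowLen_anti i (i + 1) (Nat.le_succ _)
    omega
  · by_contra! hlt
    have := startRow_le_iff.1 (Nat.le_of_lt_succ hlt)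
    omega

theorem startRow_of_notMem {A B : ℕ} {π : YoungDiagram} (hπ : π ≤ rectangle A B) {k : ℕ}
    (hk : 1 ≤ k) (h : k ∉ verticalSteps A π) : startRow A π k = startRow A π (k + 1) := by
  have h1 := startRow_le_iff.1 (le_refl (startRow A π (k + 1)))
  have h2 := startRow_le_iff.1 (le_refl (startRow A π k))
  refine le_antisymm (startRow_le_iff.2 ?_) (startRow_le_iff.2 (by omega))
  by_contra! hlt
  refine h (mem_verticalSteps.2 ⟨startRow A π (k + 1), ?_, by omega⟩)
  by_contra! hA
  have := (rowLen_le_of_le_rectangle hπ _).2 hA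
  omega

theorem startRow_one {A B : ℕ} {π : YoungDiagram} (hπ : π ≤ rectangle A B) :
    startRow A π 1 = A := by
  refine le_antisymm (startRow_le_iff.2 ?_) ?_
  · have := (rowLen_le_of_le_rectangle hπ A).2 le_rfl
    omega
  · have := startRow_le_iff.1 (le_refl (startRow A π 1))
    omega

/-! ### Diagonal slices -/

theorem rowLen_ofParts (s : Multiset ℕ) (i : ℕ) :
    (ofParts s).rowLen i = (s.sort (· ≥ ·)).getD i 0 := by
  by_cases h : i < (s.sort (· ≥ ·)).length
  · rw [List.getD_eq_getElem _ _ h]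
    exact YoungDiagram.rowLen_ofRowLens ⟨i, h⟩
  · rw [List.getD_eq_default _ _ (not_lt.1 h)]
    refine Nat.eq_zero_of_not_pos fun h' => h ?_
    exact (YoungDiagram.mem_ofRowLens.1 (YoungDiagram.mem_iff_lt_rowLen.2 h')).1

theorem card_ofParts (s : Multiset ℕ) : (ofParts s).card = s.sum := by
  have h0 : (ofParts s).rowLen (s.sort (· ≥ ·)).length = 0 := by
    rw [rowLen_ofParts, List.getD_eq_default _ _ le_rfl]
  rw [card_eq_sum_rowLen _ h0]
  conv_rhs => rw [← Multiset.sort_eq s (· ≥ ·), Multiset.sum_coe]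
  simp_rw [rowLen_ofParts]
  generalize s.sort (· ≥ ·) = l
  induction l with
  | nil => rfl
  | cons a l ih =>
    rw [List.length_cons, Finset.sum_range_succ', List.sum_cons, ← ih, add_comm]
    simp

theorem rowLen_ofParts_map_range (n : ℕ) (f : ℕ → ℕ) (hf : Antitone f) (i : ℕ) :
    (ofParts ((Multiset.range n).map f)).rowLen i = if i < n then f i else 0 := by
  have h1 : ((Multiset.range n).map f).sort (· ≥ ·) = (List.range n).map f := by
    refine List.Perm.eq_of_pairwise' (r := (· ≥ ·)) (Multiset.pairwise_sort _ _) ?_ ?_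
    · rw [List.pairwise_map]
      exact List.pairwise_lt_range.imp fun h => hf h.le
    · rw [← Multiset.coe_eq_coe, Multiset.sort_eq]
      rfl
  rw [rowLen_ofParts, h1]
  by_cases h : i < n
  · simp [h, List.getD]
  · rw [if_neg h, List.getD_eq_default]
    simpa using h

namespace SkewPlanePartition

variable {A B : ℕ} {π : YoungDiagram}

theorem entry_row_succ_le (P : SkewPlanePartition A B π) {i j : ℕ} (h : π.rowLen i ≤ j) :
    P.entry (i + 1, j) ≤ P.entry (i, j) := by
  by_cases h1 : (i + 1, j) ∈ skewCells (rectangle A B) π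
  · refine P.col_weak i j (mem_support.2 ?_) h1
    have := mem_support.1 h1
    omega
  · rw [P.zero_outside _ h1]
    exact Nat.zero_le _

theorem entry_col_succ_le (P : SkewPlanePartition A B π) {i j : ℕ} (h : π.rowLen i ≤ j) :
    P.entry (i, j + 1) ≤ P.entry (i, j) := by
  by_cases h1 : (i, j + 1) ∈ skewCells (rectangle A B) π
  · refine P.row_weak i j (mem_support.2 ?_) h1
    have := mem_support.1 h1
    omega
  · rw [P.zero_outside _ h1]
    exact Nat.zero_le _

/-- The parts of a diagonal slice are read along the diagonal, which starts at the boundary. -/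
theorem rowLen_slice (P : SkewPlanePartition A B π) (k i : ℕ) : (P.slice k).rowLen i =
    P.entry (startRow A π k + i, k + (startRow A π k + i) - (A + 1)) := by
  set r := startRow A π k with hr
  have hr0 : ∀ i, A + π.rowLen (r + i) < k + (r + i) := fun i =>
    startRow_le_iff.1 (hr ▸ Nat.le_add_right _ _)
  set f : ℕ → ℕ := fun i => P.entry (r + i, k + (r + i) - (A + 1)) with hf
  have hanti : Antitone f := by
    refine antitone_nat_of_succ_le fun i => ?_
    have h0 := hr0 i
    have h1 := π.rowLen_anti (r + i) (r + i + 1) (Nat.le_succ _)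
    have e : k + (r + (i + 1)) - (A + 1) = k + (r + i) - (A + 1) + 1 := by omega
    simp only [hf, e]
    rw [← add_assoc r]
    exact (P.entry_col_succ_le (i := r + i + 1) (by omega)).trans
      (P.entry_row_succ_le (i := r + i) (by omega))
  set n := min (A - r) (A + B + 1 - (k + r)) with hn
  have hset : (skewCells (rectangle A B) π).filter
      (fun c => (c.2 : ℤ) - (c.1 : ℤ) = (k : ℤ) - (A : ℤ) - 1) =
      (Finset.range n).map ⟨fun i => (r + i, k + (r + i) - (A + 1)), fun a b h => by
        have := (Prod.mk.inj h).1
        omega⟩ := by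
    ext ⟨a, b⟩
    rw [Finset.mem_filter, mem_support, Finset.mem_map]
    constructor
    · rintro ⟨⟨h1, h2, h3⟩, h4⟩
      dsimp only at h4
      have h5 : r ≤ a := startRow_le_iff.2 (by omega)
      have h6 : r + (a - r) = a := by omega
      refine ⟨a - r, Finset.mem_range.2 (by omega), Prod.ext h6 ?_⟩
      change k + (r + (a - r)) - (A + 1) = b
      omega
    · rintro ⟨i, hi, he⟩
      have hi := Finset.mem_range.1 hi
      have h1 : r + i = a := congrArg Prod.fst he
      have h2 : k + (r + i) - (A + 1) = b := congrArg Prod.snd he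
      have := hr0 i
      rw [h1] at this
      dsimp only
      omega
  rw [slice, hset, Finset.map_val, Multiset.map_map]
  change (ofParts ((Multiset.range n).map f)).rowLen i = f i
  rw [rowLen_ofParts_map_range n f hanti]
  split_ifs with h
  · rfl
  · refine (P.zero_outside _ fun h' => h ?_).symm
    have := mem_support.1 h'
    have := hr0 i
    omega

theorem slice_one (hπ : π ≤ rectangle A B) (P : SkewPlanePartition A B π) : P.slice 1 = ⊥ := by
  refine ext_rowLen fun i => ?_
  rw [rowLen_slice, rowLen_bot, startRow_one hπ]
  refine P.zero_outside _ fun h => ?_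
  have := mem_support.1 h
  omega

theorem slice_last (P : SkewPlanePartition A B π) : P.slice (A + B + 1) = ⊥ := by
  refine ext_rowLen fun i => ?_
  rw [rowLen_slice, rowLen_bot]
  refine P.zero_outside _ fun h => ?_
  have := mem_support.1 h
  omega

theorem slice_hStrip_of_mem (P : SkewPlanePartition A B π) {k : ℕ} (hk : k ∈ verticalSteps A π) :
    HStrip (P.slice k) (P.slice (k + 1)) := by
  intro i
  have h0 := startRow_of_mem hk
  have h1 : A + π.rowLen (startRow A π (k + 1) + i) < k + 1 + (startRow A π (k + 1) + i) :=
    startRow_le_iff.1 (Nat.le_add_right _ _)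
  have h2 : A + π.rowLen (startRow A π k + i) < k + (startRow A π k + i) :=
    startRow_le_iff.1 (Nat.le_add_right _ _)
  rw [rowLen_slice, rowLen_slice, rowLen_slice]
  rw [h0] at h2 ⊢
  generalize startRow A π (k + 1) = r at *
  have e1 : r + 1 + i = r + i + 1 := by omega
  have e2 : k + 1 + (r + i) - (A + 1) = k + (r + i + 1) - (A + 1) := by omega
  have e3 : k + 1 + (r + (i + 1)) - (A + 1) = k + (r + i + 1) - (A + 1) + 1 := by omega
  rw [e1] at h2 ⊢
  rw [e2, e3]
  exact ⟨P.entry_row_succ_le (by omega), P.entry_col_succ_le (i := r + i + 1) (by omega)⟩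

theorem slice_hStrip_of_notMem (hπ : π ≤ rectangle A B) (P : SkewPlanePartition A B π) {k : ℕ}
    (hk1 : 1 ≤ k) (hk : k ∉ verticalSteps A π) : HStrip (P.slice (k + 1)) (P.slice k) := by
  intro i
  have h0 := startRow_of_notMem hπ hk1 hk
  have h1 : A + π.rowLen (startRow A π (k + 1) + i) < k + 1 + (startRow A π (k + 1) + i) :=
    startRow_le_iff.1 (Nat.le_add_right _ _)
  have h2 : A + π.rowLen (startRow A π k + i) < k + (startRow A π k + i) :=
    startRow_le_iff.1 (Nat.le_add_right _ _)
  rw [rowLen_slice, rowLen_slice, rowLen_slice]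
  rw [h0] at *
  generalize startRow A π (k + 1) = r at *
  have e2 : k + 1 + (r + i) - (A + 1) = k + (r + i) - (A + 1) + 1 := by omega
  have e3 : k + (r + (i + 1)) - (A + 1) = k + (r + i) - (A + 1) + 1 := by omega
  rw [e2, e3]
  exact ⟨P.entry_col_succ_le (by omega), P.entry_row_succ_le (i := r + i) (by omega)⟩

theorem card_slice (P : SkewPlanePartition A B π) (k : ℕ) : (P.slice k).card =
    ∑ c ∈ (skewCells (rectangle A B) π).filter
      (fun c => (c.2 : ℤ) - (c.1 : ℤ) = (k : ℤ) - (A : ℤ) - 1), P.entry c :=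
  card_ofParts _

theorem volume_eq_sum_card_slice (P : SkewPlanePartition A B π) :
    P.volume = ∑ k ∈ Finset.range (A + B), (P.slice (k + 1)).card := by
  rw [volume, ← Finset.sum_fiberwise_of_maps_to (t := Finset.range (A + B))
    (g := fun c : ℕ × ℕ => c.2 + A - c.1)]
  · refine Finset.sum_congr rfl fun k _ => ?_
    rw [card_slice]
    refine Finset.sum_congr (Finset.filter_congr ?_) fun _ _ => rfl
    rintro ⟨i, j⟩ h
    have := mem_support.1 h
    simp only
    omega
  · rintro ⟨i, j⟩ h
    have := mem_support.1 h
    simp only [Finset.mem_range]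
    omega

/-- A skew plane partition is determined by its slices. -/
theorem ext_slice {P Q : SkewPlanePartition A B π}
    (h : ∀ k < A + B, P.slice (k + 1) = Q.slice (k + 1)) : P = Q := by
  ext ⟨i, j⟩
  by_cases hc : (i, j) ∈ skewCells (rectangle A B) π
  · have h1 := mem_support.1 hc
    have h2 : startRow A π (j + A - i + 1) ≤ i := startRow_le_iff.2 (by omega)
    have h3 := congrArg (fun μ => μ.rowLen (i - startRow A π (j + A - i + 1)))
      (h (j + A - i) (by omega))
    simp only [rowLen_slice] at h3
    have e1 : startRow A π (j + A - i + 1) + (i - startRow A π (j + A - i + 1)) = i := by omega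
    have e2 : j + A - i + 1 + i - (A + 1) = j := by omega
    rwa [e1, e2] at h3
  · rw [P.zero_outside _ hc, Q.zero_outside _ hc]

end SkewPlanePartition

/-! ### Skew plane partitions as sequences of interlacing diagrams -/

/-- The sequences of diagrams that occur as the slices of a skew plane partition. -/
structure IsSliceSequence (A B : ℕ) (π : YoungDiagram) (S : ℕ → YoungDiagram) : Prop where
  first : S 1 = ⊥
  last : S (A + B + 1) = ⊥
  up : ∀ k, 1 ≤ k → k ≤ A + B → k ∈ verticalSteps A π → HStrip (S k) (S (k + 1))
  down : ∀ k, 1 ≤ k → k ≤ A + B → k ∉ verticalSteps A π → HStrip (S (k + 1)) (S k)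

namespace IsSliceSequence

variable {A B : ℕ} {π : YoungDiagram} {S : ℕ → YoungDiagram}

theorem startRow_le (hπ : π ≤ rectangle A B) {k : ℕ} (hk : 1 ≤ k) : startRow A π k ≤ A := by
  refine startRow_le_iff.2 ?_
  have := (rowLen_le_of_le_rectangle hπ A).2 le_rfl
  omega

/-- A slice has at most as many parts as there are rows below the point of the boundary. -/
theorem rowLen_eq_zero_of_row (h : IsSliceSequence A B π S) (hπ : π ≤ rectangle A B) {k : ℕ}
    (hk1 : 1 ≤ k) : k ≤ A + B + 1 → (S k).rowLen (A - startRow A π k) = 0 := by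
  induction k, hk1 using Nat.le_induction with
  | base => intro _; rw [h.first, rowLen_bot]
  | succ k hk1 ih =>
    intro hk
    have ih := ih (by omega)
    by_cases hv : k ∈ verticalSteps A π
    · have h1 := startRow_of_mem hv
      have h2 := startRow_le hπ hk1
      have h3 := (h.up k hk1 (by omega) hv (A - startRow A π k)).2
      have e : A - startRow A π (k + 1) = A - startRow A π k + 1 := by omega
      rw [e]
      omega
    · have h1 := startRow_of_notMem hπ hk1 hv
      have h3 := (h.down k hk1 (by omega) hv (A - startRow A π k)).1
      rw [← h1]
      omega

/-- A slice has at most as many parts as there are columns to the right of the point of the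
boundary. -/
theorem rowLen_eq_zero_of_col (h : IsSliceSequence A B π S) (hπ : π ≤ rectangle A B) {k : ℕ}
    (hk : k ≤ A + B + 1) :
    1 ≤ k → (S k).rowLen (A + B + 1 - (k + startRow A π k)) = 0 := by
  induction hk using Nat.decreasingInduction with
  | self => intro _; rw [h.last, rowLen_bot]
  | of_succ k hk ih =>
    intro hk1
    have ih := ih (by omega)
    have hb := startRow_le_iff.1 (le_refl (startRow A π (k + 1)))
    by_cases hv : k ∈ verticalSteps A π
    · have h1 := startRow_of_mem hv
      have h3 := (h.up k hk1 (by omega) hv (A + B + 1 - (k + startRow A π k))).1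
      have e : A + B + 1 - (k + 1 + startRow A π (k + 1)) =
        A + B + 1 - (k + startRow A π k) := by omega
      rw [e] at ih
      omega
    · have h1 := startRow_of_notMem hπ hk1 hv
      have h3 := (h.down k hk1 (by omega) hv (A + B + 1 - (k + 1 + startRow A π (k + 1)))).2
      rw [ih] at h3
      -- The point `k` lies in the rectangle, strictly to the left of its right side.
      have hle : startRow A π (k + 1) + k ≤ A + B := by
        by_contra! hgt
        have h4 : startRow A π (k + 1) ≤ A + B - k := by
          refine startRow_le_iff.2 ?_
          have := (rowLen_le_of_le_rectangle hπ (A + B - k)).1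
          have := (rowLen_le_of_le_rectangle hπ (A + B - k)).2
          omega
        omega
      have e : A + B + 1 - (k + startRow A π k) =
        A + B + 1 - (k + 1 + startRow A π (k + 1)) + 1 := by omega
      rw [e]
      omega

/-- The filling with prescribed slices. -/
def toSkewPlanePartition (h : IsSliceSequence A B π S) (hπ : π ≤ rectangle A B) :
    SkewPlanePartition A B π where
  entry c := if c ∈ skewCells (rectangle A B) π then
    (S (c.2 + A + 1 - c.1)).rowLen (c.1 - startRow A π (c.2 + A + 1 - c.1)) else 0
  zero_outside c hc := if_neg hc
  col_weak i j hc hd := by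
    rw [if_pos hc, if_pos hd]
    have h1 := mem_support.1 hc
    have h2 := mem_support.1 hd
    obtain ⟨k, hk⟩ : ∃ k, j + A + 1 - (i + 1) = k := ⟨_, rfl⟩
    have hk' : j + A + 1 - i = k + 1 := by omega
    simp only [hk, hk']
    have h3 : startRow A π (k + 1) ≤ i := startRow_le_iff.2 (by omega)
    have h4 : startRow A π k ≤ i + 1 := startRow_le_iff.2 (by omega)
    by_cases hv : k ∈ verticalSteps A π
    · have h5 := startRow_of_mem hv
      have e : i + 1 - startRow A π k = i - startRow A π (k + 1) := by omega
      rw [e]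
      exact (h.up k (by omega) (by omega) hv _).1
    · have h5 := startRow_of_notMem hπ (by omega) hv
      have e : i + 1 - startRow A π k = i - startRow A π (k + 1) + 1 := by omega
      rw [e]
      exact (h.down k (by omega) (by omega) hv _).2
  row_weak i j hc hd := by
    rw [if_pos hc, if_pos hd]
    have h1 := mem_support.1 hc
    have h2 := mem_support.1 hd
    obtain ⟨k, hk⟩ : ∃ k, j + A + 1 - i = k := ⟨_, rfl⟩
    have hk' : j + 1 + A + 1 - i = k + 1 := by omega
    simp only [hk, hk']
    have h3 : startRow A π (k + 1) ≤ i := startRow_le_iff.2 (by omega)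
    have h4 : startRow A π k ≤ i := startRow_le_iff.2 (by omega)
    by_cases hv : k ∈ verticalSteps A π
    · have h5 := startRow_of_mem hv
      have e : i - startRow A π (k + 1) = i - startRow A π k + 1 := by omega
      rw [e]
      exact (h.up k (by omega) (by omega) hv _).2
    · have h5 := startRow_of_notMem hπ (by omega) hv
      rw [h5]
      exact (h.down k (by omega) (by omega) hv _).1

theorem slice_toSkewPlanePartition (h : IsSliceSequence A B π S) (hπ : π ≤ rectangle A B) {k : ℕ}
    (hk1 : 1 ≤ k) (hk : k ≤ A + B + 1) : (h.toSkewPlanePartition hπ).slice k = S k := by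
  refine ext_rowLen fun i => ?_
  rw [SkewPlanePartition.rowLen_slice]
  have hb : A + π.rowLen (startRow A π k + i) < k + (startRow A π k + i) :=
    startRow_le_iff.1 (Nat.le_add_right _ _)
  have h1 := h.rowLen_eq_zero_of_row hπ hk1 hk
  have h2 := h.rowLen_eq_zero_of_col hπ hk hk1
  simp only [toSkewPlanePartition]
  split_ifs with hc
  · have h3 := mem_support.1 hc
    have e : k + (startRow A π k + i) - (A + 1) + A + 1 - (startRow A π k + i) = k := by omega
    rw [e, Nat.add_sub_cancel_left]
  · rw [mem_support] at hc
    by_cases h3 : A - startRow A π k ≤ i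
    · exact (rowLen_eq_zero_of_le h1 h3).symm
    · exact (rowLen_eq_zero_of_le h2 (by omega)).symm

end IsSliceSequence

/-! ### The weight of a skew plane partition as a product over the boundary path -/

/-- The step from the point `k` to the point `k + 1` of the boundary, with the weight that
summation by parts gives it: with `b = A + π_1 + 1` the last point of the top vertical segment, a
box added by a vertical step has weight `q ^ (b - k)`, and a box removed by a horizontal step has
weight `q ^ (k - b)`. -/
def boundaryStep (A : ℕ) (π : YoungDiagram) (q : ℝ) (k : ℕ) : Bool × ℝ≥0∞ :=
  if k ∈ verticalSteps A π then
    (true, ENNReal.ofReal (q ^ (((A + π.rowLen 0 + 1 : ℕ) : ℤ) - k)))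
  else (false, ENNReal.ofReal (q ^ ((k : ℤ) - ((A + π.rowLen 0 + 1 : ℕ) : ℤ))))

/-- The transfer kernel from the point `k` to the point `k + 1` of the boundary. -/
def boundaryKernel (A : ℕ) (π : YoungDiagram) (q : ℝ) (k : ℕ) : Transfer :=
  Transfer.letter (boundaryStep A π q k)

theorem boundaryKernel_of_mem {A : ℕ} {π : YoungDiagram} {q : ℝ} {k : ℕ}
    (hk : k ∈ verticalSteps A π) : boundaryKernel A π q k =
      Transfer.up (ENNReal.ofReal (q ^ (((A + π.rowLen 0 + 1 : ℕ) : ℤ) - k))) := by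
  rw [boundaryKernel, boundaryStep, if_pos hk]
  rfl

theorem boundaryKernel_of_notMem {A : ℕ} {π : YoungDiagram} {q : ℝ} {k : ℕ}
    (hk : k ∉ verticalSteps A π) : boundaryKernel A π q k =
      Transfer.down (ENNReal.ofReal (q ^ ((k : ℤ) - ((A + π.rowLen 0 + 1 : ℕ) : ℤ)))) := by
  rw [boundaryKernel, boundaryStep, if_neg hk]
  rfl

theorem up_zpow {q : ℝ} (hq : 0 < q) (z : ℤ) {μ ν : YoungDiagram} (h : HStrip μ ν) :
    Transfer.up (ENNReal.ofReal (q ^ z)) μ ν =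
      ENNReal.ofReal (q ^ (z * ((ν.card : ℤ) - μ.card))) := by
  rw [Transfer.up_of_hStrip h, ← ENNReal.ofReal_pow (by positivity), ← zpow_natCast, ← zpow_mul,
    Nat.cast_sub h.card_le]

section

variable {A B : ℕ} {π : YoungDiagram}

theorem boundaryKernel_slice (hπ : π ≤ rectangle A B) {q : ℝ} (hq : 0 < q)
    (P : SkewPlanePartition A B π) {k : ℕ} (hk : 1 ≤ k) :
    boundaryKernel A π q k (P.slice k) (P.slice (k + 1)) =
      ENNReal.ofReal (q ^ ((((A + π.rowLen 0 + 1 : ℕ) : ℤ) - k) *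
        (((P.slice (k + 1)).card : ℤ) - (P.slice k).card))) := by
  by_cases hv : k ∈ verticalSteps A π
  · rw [boundaryKernel_of_mem hv, up_zpow hq _ (P.slice_hStrip_of_mem hv)]
  · rw [boundaryKernel_of_notMem hv, Transfer.down,
      up_zpow hq _ (P.slice_hStrip_of_notMem hπ hk hv)]
    congr 2
    ring

/-- Summation by parts along the boundary path. -/
theorem prod_boundaryKernel_slice (hπ : π ≤ rectangle A B) {q : ℝ} (hq : 0 < q)
    (P : SkewPlanePartition A B π) (n : ℕ) :
    ∏ k ∈ Finset.range n, boundaryKernel A π q (k + 1) (P.slice (k + 1)) (P.slice (k + 2)) =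
      ENNReal.ofReal (q ^ (∑ k ∈ Finset.range n, ((P.slice (k + 1)).card : ℤ) +
        (((A + π.rowLen 0 + 1 : ℕ) : ℤ) - n) * (P.slice (n + 1)).card)) := by
  induction n with
  | zero => simp [P.slice_one hπ]
  | succ n ih =>
    rw [Finset.prod_range_succ, ih, boundaryKernel_slice hπ hq P (Nat.le_add_left 1 n),
      ← ENNReal.ofReal_mul (by positivity), ← zpow_add₀ hq.ne', Finset.sum_range_succ]
    congr 2
    push_cast
    ring

theorem prod_boundaryKernel_slice_eq (hπ : π ≤ rectangle A B) {q : ℝ} (hq : 0 < q)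
    (P : SkewPlanePartition A B π) :
    ∏ i : Fin (A + B), boundaryKernel A π q (1 + i) (P.slice (i + 1)) (P.slice (i + 2)) =
      ENNReal.ofReal (q ^ P.volume) := by
  simp_rw [add_comm 1]
  rw [Fin.prod_univ_eq_prod_range
    (fun k => boundaryKernel A π q (k + 1) (P.slice (k + 1)) (P.slice (k + 2))),
    prod_boundaryKernel_slice hπ hq, P.slice_last, card_bot, P.volume_eq_sum_card_slice,
    ← zpow_natCast]
  simp

theorem isSliceSequence_of_boundaryKernel_ne_zero {q : ℝ} {S : ℕ → YoungDiagram} (h1 : S 1 = ⊥)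
    (h2 : S (A + B + 1) = ⊥)
    (h : ∀ k, 1 ≤ k → k ≤ A + B → boundaryKernel A π q k (S k) (S (k + 1)) ≠ 0) :
    IsSliceSequence A B π S where
  first := h1
  last := h2
  up k hk1 hk hv := by
    by_contra hn
    refine h k hk1 hk ?_
    rw [boundaryKernel_of_mem hv, Transfer.up_of_not_hStrip hn]
  down k hk1 hk hv := by
    by_contra hn
    refine h k hk1 hk ?_
    rw [boundaryKernel_of_notMem hv, Transfer.down, Transfer.up_of_not_hStrip hn]

open Classical in
/-- The restriction of a kernel to rows that satisfy a condition. -/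
def Transfer.restrict (φ : YoungDiagram → Prop) (K : Transfer) : Transfer :=
  fun μ ν => if φ μ then K μ ν else 0

open Classical in
/-- The total weight of the skew plane partitions with conditions on their slices is a matrix
element of a product of kernels. -/
theorem tsum_weight_eq_prod (hπ : π ≤ rectangle A B) {q : ℝ} (hq : 0 < q)
    (φ : ℕ → YoungDiagram → Prop) :
    (∑' P : SkewPlanePartition A B π, if ∀ i : Fin (A + B), φ (1 + i) (P.slice (i + 1)) then
      ENNReal.ofReal (q ^ P.volume) else 0) =
    ((List.range' 1 (A + B)).map fun k => (boundaryKernel A π q k).restrict (φ k)).prod ⊥ ⊥ := by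
  rw [Transfer.prod_range'_apply]
  let g : SkewPlanePartition A B π → (Fin (A + B + 1) → YoungDiagram) :=
    fun P i => P.slice (i + 1)
  have hg : Function.Injective g := fun P Q h =>
    SkewPlanePartition.ext_slice fun k hk => congrFun h ⟨k, by omega⟩
  rw [← hg.tsum_eq]
  · refine tsum_congr fun P => ?_
    have h0 : g P 0 = ⊥ ∧ g P (Fin.last (A + B)) = ⊥ := ⟨P.slice_one hπ, P.slice_last⟩
    rw [if_pos h0]
    have h1 : ∏ i : Fin (A + B), (boundaryKernel A π q (1 + i)).restrict (φ (1 + i))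
        (g P i.castSucc) (g P i.succ) = ∏ i : Fin (A + B),
        if φ (1 + i) (P.slice (i + 1)) then
          boundaryKernel A π q (1 + i) (P.slice (i + 1)) (P.slice (i + 2)) else 0 := rfl
    rw [h1, Finset.prod_ite_zero, prod_boundaryKernel_slice_eq hπ hq]
    simp
  · intro s hs
    rw [Function.mem_support] at hs
    have h0 : s 0 = ⊥ ∧ s (Fin.last (A + B)) = ⊥ := by
      by_contra h
      exact hs (if_neg h)
    rw [if_pos h0, Finset.prod_ne_zero_iff] at hs
    let S : ℕ → YoungDiagram := fun k => if h : k - 1 < A + B + 1 then s ⟨k - 1, h⟩ else ⊥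
    have hS : ∀ i : Fin (A + B + 1), S (i + 1) = s i := fun i => dif_pos i.2
    have hSS : IsSliceSequence A B π S := by
      refine isSliceSequence_of_boundaryKernel_ne_zero (q := q) ?_ ?_ fun k hk1 hk => ?_
      · exact (hS 0).trans h0.1
      · exact (hS (Fin.last _)).trans h0.2
      · have := hs ⟨k - 1, by omega⟩ (Finset.mem_univ _)
        rw [Transfer.restrict] at this
        rw [ne_eq, ite_eq_right_iff, Classical.not_imp] at this
        have e1 : 1 + (k - 1) = k := by omega
        have e2 : S k = s (Fin.castSucc ⟨k - 1, by omega⟩) := by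
          rw [← hS]
          congr 1
          simp only [Fin.castSucc_mk]
          omega
        have e3 : S (k + 1) = s (Fin.succ ⟨k - 1, by omega⟩) := by
          rw [← hS]
          congr 1
          simp only [Fin.succ_mk]
          omega
        rw [e2, e3]
        simpa only [e1] using this.2
    refine ⟨hSS.toSkewPlanePartition hπ, funext fun i => ?_⟩
    rw [← hS]
    exact hSS.slice_toSkewPlanePartition hπ (Nat.le_add_left _ _) (by omega)

end

/-! ### Cutting a product of kernels at prescribed diagrams -/

/-- The product of the kernels `K k` with `a ≤ k < b`. -/
def Transfer.segment (K : ℕ → Transfer) (a b : ℕ) : Transfer := ((List.range' a (b - a)).map K).prod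

namespace Transfer

theorem segment_mul (K : ℕ → Transfer) {a b c : ℕ} (hab : a ≤ b) (hbc : b ≤ c) :
    segment K a b * segment K b c = segment K a c := by
  have h := List.range'_append_1 (s := a) (m := b - a) (n := c - b)
  rw [show a + (b - a) = b by omega, show b - a + (c - b) = c - a by omega] at h
  rw [segment, segment, segment, ← h, List.map_append, List.prod_append]

theorem segment_congr {K M : ℕ → Transfer} {a b : ℕ} (h : ∀ k, a ≤ k → k < b → K k = M k) :
    segment K a b = segment M a b := by
  rw [segment, segment]
  congr 1
  refine List.map_congr_left fun k hk => ?_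
  rw [List.mem_range'_1] at hk
  exact h k hk.1 (by omega)

theorem segment_succ (K : ℕ → Transfer) {a b : ℕ} (hab : a < b) :
    segment K a b = K a * segment K (a + 1) b := by
  rw [segment, segment, show b - a = b - (a + 1) + 1 by omega, List.range'_succ, List.map_cons,
    List.prod_cons]

open Classical in
theorem segment_restrict_apply {K M : ℕ → Transfer} {a b : ℕ} (hab : a < b) (lam : YoungDiagram)
    (h : ∀ k, a < k → k < b → M k = K k) (ha : M a = (K a).restrict (· = lam))
    (μ ν : YoungDiagram) :
    segment M a b μ ν = if μ = lam then segment K a b μ ν else 0 := by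
  rw [segment_succ M hab, segment_succ K hab, segment_congr (K := M) (M := K)
    fun k h1 h2 => h k (by omega) h2, ha, mul_apply, mul_apply]
  split_ifs with hμ
  · exact tsum_congr fun ρ => by rw [restrict, if_pos hμ]
  · exact ENNReal.tsum_eq_zero.2 fun ρ => by rw [restrict, if_neg hμ, zero_mul]

theorem mul_segment_restrict {K M : ℕ → Transfer} {a b c : ℕ} (hca : c ≤ a) (hab : a < b)
    (lam : YoungDiagram) (h : ∀ k, a < k → k < b → M k = K k)
    (ha : M a = (K a).restrict (· = lam)) (μ ν : YoungDiagram) :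
    segment M c b μ ν = segment M c a μ lam * segment K a b lam ν := by
  rw [← segment_mul M hca hab.le, mul_apply, tsum_eq_single lam fun ρ hρ => by
    rw [segment_restrict_apply hab lam h ha, if_neg hρ, mul_zero],
    segment_restrict_apply hab lam h ha, if_pos rfl]

theorem segment_restrict_eq_prod (K : ℕ → Transfer) {m : ℕ} {α : Fin (m + 1) → ℕ}
    (hα : StrictMono α) (lam : Fin (m + 1) → YoungDiagram) {c N : ℕ} (hc : c ≤ α 0)
    (hN : α (Fin.last m) < N) (μ ν : YoungDiagram) :
    segment (fun k => (K k).restrict fun κ => ∀ i, α i = k → κ = lam i) c N μ ν =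
      segment K c (α 0) μ (lam 0) *
      (∏ i : Fin m, segment K (α i.castSucc) (α i.succ) (lam i.castSucc) (lam i.succ)) *
      segment K (α (Fin.last m)) N (lam (Fin.last m)) ν := by
  set M : ℕ → Transfer := fun k => (K k).restrict fun κ => ∀ i, α i = k → κ = lam i with hM
  have hfree : ∀ k, (∀ i, α i ≠ k) → M k = K k := by
    intro k hk
    ext κ ρ
    exact if_pos fun i hi => absurd hi (hk i)
  have hfix : ∀ i, M (α i) = (K (α i)).restrict (· = lam i) := by
    intro i
    ext κ ρ
    have : (∀ j, α j = α i → κ = lam j) ↔ κ = lam i :=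
      ⟨fun h => h i rfl, fun h j hj => hα.injective hj ▸ h⟩
    simp only [hM, restrict]
    by_cases h : κ = lam i
    · rw [if_pos (this.2 h), if_pos h]
    · rw [if_neg (mt this.1 h), if_neg h]
  have hmono : ∀ i, c ≤ α i := fun i => hc.trans (hα.monotone (Fin.zero_le i))
  have key : ∀ j : Fin (m + 1), segment M c (α j) μ (lam j) = segment K c (α 0) μ (lam 0) *
      ∏ i : Fin m with i.castSucc < j,
        segment K (α i.castSucc) (α i.succ) (lam i.castSucc) (lam i.succ) := by
    intro j
    induction j using Fin.induction with
    | zero =>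
      rw [Finset.filter_false_of_mem fun i _ => Fin.not_lt_zero _, Finset.prod_empty, mul_one,
        segment_congr (K := M) (M := K)]
      intro k _ hk
      exact hfree k fun i hi => absurd (hα.monotone (Fin.zero_le i)) (by omega)
    | succ j ih =>
      have h1 : (Finset.univ.filter fun i : Fin m => i.castSucc < j.succ) =
          insert j (Finset.univ.filter fun i : Fin m => i.castSucc < j.castSucc) := by
        ext i
        simp only [Finset.mem_filter, Finset.mem_univ, true_and, Finset.mem_insert, Fin.lt_def,
          Fin.ext_iff, Fin.val_castSucc, Fin.val_succ]
        omega
      rw [h1, Finset.prod_insert (by simp), mul_left_comm, ← ih, mul_comm]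
      refine mul_segment_restrict (hmono _) (hα Fin.castSucc_lt_succ) _ (fun k hk1 hk2 => ?_)
        (hfix _) μ _
      refine hfree k fun i hi => ?_
      rw [← hi, hα.lt_iff_lt] at hk1 hk2
      simp only [Fin.lt_def, Fin.val_castSucc, Fin.val_succ] at hk1 hk2
      omega
  rw [mul_segment_restrict (hmono _) hN (lam (Fin.last m)) _ (hfix _) μ ν, key,
    Finset.filter_true_of_mem fun i _ => Fin.castSucc_lt_last i]
  intro k hk _
  exact hfree k fun i hi => absurd (hα.monotone (Fin.le_last i)) (by omega)

end Transfer

/-! ### The end points of the vertical segments -/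

theorem mem_segmentEnds {A : ℕ} {π : YoungDiagram} {j : ℕ} :
    j + 1 ∈ segmentEnds A π ↔ ¬ (j ∈ verticalSteps A π ↔ j + 1 ∈ verticalSteps A π) := by
  rw [segmentEnds, Finset.mem_symmDiff, Finset.mem_image]
  have : (∃ a ∈ verticalSteps A π, a + 1 = j + 1) ↔ j ∈ verticalSteps A π :=
    ⟨fun ⟨a, ha, h⟩ => Nat.succ_injective h ▸ ha, fun h => ⟨j, h, rfl⟩⟩
  rw [this]
  tauto

theorem verticalSteps_bounds {A : ℕ} {π : YoungDiagram} {j : ℕ} (h : j ∈ verticalSteps A π) :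
    1 ≤ j ∧ j ≤ A + π.rowLen 0 := by
  obtain ⟨i, hi, he⟩ := mem_verticalSteps.1 h
  have := π.rowLen_anti 0 i (Nat.zero_le _)
  omega

theorem le_of_mem_segmentEnds {A : ℕ} {π : YoungDiagram} {e : ℕ} (h : e ∈ segmentEnds A π) :
    e ≤ A + π.rowLen 0 + 1 := by
  rw [segmentEnds, Finset.mem_symmDiff, Finset.mem_image] at h
  rcases h with ⟨h, _⟩ | ⟨⟨a, h, rfl⟩, _⟩ <;>
  · have := verticalSteps_bounds h
    omega

/-- The number of end points of vertical segments that lie above the point `j`. -/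
def endsAbove (A : ℕ) (π : YoungDiagram) (j : ℕ) : ℕ :=
  ((segmentEnds A π).filter (j < ·)).card

/-- The step from `j` to `j + 1` is vertical if and only if an odd number of end points of vertical
segments lies above `j`. -/
theorem mem_verticalSteps_iff_odd {A : ℕ} {π : YoungDiagram} (j : ℕ) :
    j ∈ verticalSteps A π ↔ Odd (endsAbove A π j) := by
  obtain ⟨N, hj, hN⟩ : ∃ N, j ≤ N ∧ A + π.rowLen 0 + 1 ≤ N :=
    ⟨j + (A + π.rowLen 0 + 1), by omega, by omega⟩
  induction hj using Nat.decreasingInduction with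
  | self =>
    have h1 : endsAbove A π N = 0 := by
      rw [endsAbove, Finset.card_eq_zero, Finset.filter_eq_empty_iff]
      intro e he
      have := le_of_mem_segmentEnds he
      omega
    rw [h1]
    refine iff_of_false (fun h => ?_) (by decide)
    have := verticalSteps_bounds h
    omega
  | of_succ j _ ih =>
    have ih : j + 1 ∈ verticalSteps A π ↔ Odd (endsAbove A π (j + 1)) := ih
    have h1 : endsAbove A π j = endsAbove A π (j + 1) +
        if j + 1 ∈ segmentEnds A π then 1 else 0 := by
      have h2 : (segmentEnds A π).filter (j < ·) = (segmentEnds A π).filter (j + 1 < ·) ∪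
          (segmentEnds A π).filter (· = j + 1) := by
        rw [← Finset.filter_or]
        exact Finset.filter_congr fun e _ => by omega
      rw [endsAbove, h2, Finset.card_union_of_disjoint
        (Finset.disjoint_filter.2 fun e _ h3 h4 => by omega), Finset.filter_eq', endsAbove]
      split_ifs <;> simp
    have h2 := mem_segmentEnds (A := A) (π := π) (j := j)
    rw [h1]
    split_ifs with h
    · rw [Nat.odd_add_one, ← ih]
      tauto
    · rw [add_zero, ← ih]
      tauto

theorem lt_countP_iff_lt_getD {l : List ℕ} (hl : l.Pairwise (· ≥ ·)) (j n : ℕ) :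
    n < l.countP (j < ·) ↔ j < l.getD n 0 := by
  induction l generalizing n with
  | nil => simp
  | cons x l ih =>
    rw [List.pairwise_cons] at hl
    by_cases hx : j < x
    · rw [List.countP_cons_of_pos (by simpa using hx)]
      cases n with
      | zero => simpa using hx
      | succ n => simpa using ih hl.2 n
    · have h0 : l.countP (j < ·) = 0 := by
        rw [List.countP_eq_zero]
        intro y hy
        have := hl.1 y hy
        simp only [decide_eq_true_eq]
        omega
      rw [List.countP_cons_of_neg (by simpa using hx), h0]
      refine iff_of_false (Nat.not_lt_zero _) ?_
      have h1 := ih hl.2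
      cases n with
      | zero => simpa using hx
      | succ n =>
        rw [List.getD_cons_succ, ← h1, h0]
        exact Nat.not_lt_zero _

theorem lt_endsAbove_iff {A : ℕ} {π : YoungDiagram} {j n : ℕ} :
    n < endsAbove A π j ↔ j < beta A π (n + 1) := by
  rw [beta, Nat.add_sub_cancel,
    ← lt_countP_iff_lt_getD (Finset.pairwise_sort (segmentEnds A π) (· ≥ ·)), endsAbove,
    Finset.card_def, Finset.filter_val, ← Multiset.countP_eq_card_filter,
    ← Finset.sort_eq (segmentEnds A π) (· ≥ ·), Multiset.coe_countP]

theorem beta_succ_le {A : ℕ} {π : YoungDiagram} (n : ℕ) :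
    beta A π (n + 2) ≤ beta A π (n + 1) := by
  by_contra! h
  have := lt_endsAbove_iff.2 h
  exact lt_irrefl _ (lt_endsAbove_iff.1 (Nat.lt_of_succ_lt this))

theorem beta_le_beta {A : ℕ} {π : YoungDiagram} {m n : ℕ} (hm : 1 ≤ m) (hmn : m ≤ n) :
    beta A π n ≤ beta A π m := by
  induction n, hmn using Nat.le_induction with
  | base => exact le_rfl
  | succ n hmn ih =>
    obtain ⟨k, rfl⟩ : ∃ k, n = k + 1 := ⟨n - 1, by omega⟩
    exact (beta_succ_le k).trans ih

theorem card_segmentEnds (A : ℕ) (π : YoungDiagram) :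
    (segmentEnds A π).card = 2 * numSegments A π := by
  have h1 : ((verticalSteps A π).image (· + 1) \ verticalSteps A π).card =
      (verticalSteps A π \ (verticalSteps A π).image (· + 1)).card :=
    Finset.card_sdiff_comm (Finset.card_image_of_injective _ (add_left_injective 1))
  rw [segmentEnds, symmDiff_def, Finset.sup_eq_union, Finset.card_union_of_disjoint
    disjoint_sdiff_sdiff, h1, numSegments, two_mul]

/-- The vertical steps are exactly those in the segments `[β_{2k}, β_{2k-1}]`. -/
theorem mem_verticalSteps_iff_beta {A : ℕ} {π : YoungDiagram} (j : ℕ) :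
    j ∈ verticalSteps A π ↔ ∃ k, 1 ≤ k ∧ k ≤ numSegments A π ∧
      beta A π (2 * k) ≤ j ∧ j < beta A π (2 * k - 1) := by
  have hle : endsAbove A π j ≤ 2 * numSegments A π :=
    (Finset.card_filter_le _ _).trans (card_segmentEnds A π).le
  have h2 : ∀ k, 1 ≤ k → (beta A π (2 * k) ≤ j ↔ endsAbove A π j ≤ 2 * k - 1) := by
    intro k hk
    have := lt_endsAbove_iff (A := A) (π := π) (j := j) (n := 2 * k - 1)
    rw [show 2 * k - 1 + 1 = 2 * k by omega] at this
    omega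
  have h3 : ∀ k, 1 ≤ k → (j < beta A π (2 * k - 1) ↔ 2 * k - 2 < endsAbove A π j) := by
    intro k hk
    have := lt_endsAbove_iff (A := A) (π := π) (j := j) (n := 2 * k - 2)
    rw [show 2 * k - 2 + 1 = 2 * k - 1 by omega] at this
    omega
  rw [mem_verticalSteps_iff_odd]
  constructor
  · rintro ⟨k, hk⟩
    exact ⟨k + 1, by omega, by omega, (h2 _ (by omega)).2 (by omega),
      (h3 _ (by omega)).2 (by omega)⟩
  · rintro ⟨k, hk1, hk, h4, h5⟩
    rw [h2 k hk1] at h4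
    rw [h3 k hk1] at h5
    exact ⟨k - 1, by omega⟩

theorem mem_verticalSteps_of_top {A : ℕ} {π : YoungDiagram} {j : ℕ} (h2 : beta A π 2 ≤ j)
    (h1 : j < beta A π 1) : j ∈ verticalSteps A π := by
  have e1 := lt_endsAbove_iff.2 (show j < beta A π (0 + 1) from h1)
  have e2 := (lt_endsAbove_iff (A := A) (π := π) (j := j) (n := 1)).1
  rw [mem_verticalSteps_iff_odd]
  have : endsAbove A π j = 1 := by
    have : ¬ 1 < endsAbove A π j := fun h => absurd (e2 h) (not_lt.2 h2)
    omega
  rw [this]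
  exact odd_one

theorem beta_one {A : ℕ} {π : YoungDiagram} (h : 0 < beta A π 1) :
    beta A π 1 = A + π.rowLen 0 + 1 := by
  have h0 : 0 < endsAbove A π 0 := lt_endsAbove_iff.2 h
  obtain ⟨e, he⟩ := Finset.card_pos.1 h0
  have hA : 0 < A := by
    have he' := (Finset.mem_filter.1 he).1
    rw [segmentEnds, Finset.mem_symmDiff, Finset.mem_image] at he'
    rcases he' with ⟨h, _⟩ | ⟨⟨a, h, rfl⟩, _⟩ <;>
    · obtain ⟨i, hi, _⟩ := mem_verticalSteps.1 h
      omega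
  have h1 : A + π.rowLen 0 ∈ verticalSteps A π := mem_verticalSteps.2 ⟨0, hA, rfl⟩
  have h2 : 0 < endsAbove A π (A + π.rowLen 0) := ((mem_verticalSteps_iff_odd _).1 h1).pos
  have h3 : A + π.rowLen 0 < beta A π 1 := lt_endsAbove_iff.1 h2
  refine le_antisymm ?_ h3
  by_contra! h4
  have h5 : 0 < endsAbove A π (A + π.rowLen 0 + 1) := lt_endsAbove_iff.2 h4
  obtain ⟨e, he⟩ := Finset.card_pos.1 h5
  rw [Finset.mem_filter] at he
  have := le_of_mem_segmentEnds he.1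
  omega

/-! ### The variables of the Schur functions -/

/-- The variable that belongs to the vertical step from `j` to `j + 1`. -/
def stepVariable (A : ℕ) (π : YoungDiagram) (q : ℝ) (j : ℕ) : ℝ :=
  q ^ (((A + π.rowLen 0 + 1 : ℕ) : ℤ) - j)

theorem geom_eq_map_range (q : ℝ) (t s : ℤ) :
    geom q t s = (List.range (s + 1 - t).toNat).map fun i : ℕ => q ^ (t + (i : ℤ)) := by
  rw [geom, List.ofFn_eq_map, ← List.map_coe_finRange_eq_range, List.map_map]
  rfl

theorem geom_perm (A : ℕ) (π : YoungDiagram) (q : ℝ) (a c : ℕ) :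
    (geom q (A + π.rowLen 0 + 2 - a) (A + π.rowLen 0 + 1 - c)).Perm
      ((List.range' c (a - c)).map (stepVariable A π q)) := by
  refine List.Perm.trans (List.Perm.of_eq ?_) ((List.reverse_perm _).map _)
  rw [geom_eq_map_range, List.reverse_range', List.map_map]
  have h : ((A : ℤ) + π.rowLen 0 + 1 - c + 1 - (A + π.rowLen 0 + 2 - a)).toNat = a - c := by omega
  rw [h]
  refine List.map_congr_left fun i hi => ?_
  rw [List.mem_range] at hi
  rw [Function.comp_apply, stepVariable]
  congr 1
  omega

theorem initialVariables_perm {A : ℕ} {π : YoungDiagram} (q : ℝ) {a : ℕ} (h2 : beta A π 2 ≤ a)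
    (h1 : a ≤ beta A π 1) : (initialVariables A π q a).Perm
      (((List.range' 1 (a - 1)).filter (· ∈ verticalSteps A π)).map (stepVariable A π q)) := by
  let J : List ℕ := List.range' (beta A π 2) (a - beta A π 2) ++
    (List.range' 2 (numSegments A π - 1)).flatMap fun k =>
      List.range' (beta A π (2 * k)) (beta A π (2 * k - 1) - beta A π (2 * k))
  have hJ : (initialVariables A π q a).Perm (J.map (stepVariable A π q)) := by
    rw [initialVariables, List.map_append, List.map_flatMap]
    exact (geom_perm A π q a _).append (List.Perm.flatMap_left _ fun k _ => geom_perm A π q _ _)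
  refine hJ.trans (List.Perm.map _ ?_)
  have hmem : ∀ k j, j ∈ List.range' (beta A π (2 * k)) (beta A π (2 * k - 1) - beta A π (2 * k)) ↔
      beta A π (2 * k) ≤ j ∧ j < beta A π (2 * k - 1) := by
    intro k j
    rw [List.mem_range'_1]
    omega
  refine (List.perm_ext_iff_of_nodup ?_ (List.Nodup.filter _ List.nodup_range')).2 fun j => ?_
  · refine List.Nodup.append List.nodup_range' (List.nodup_flatMap.2
      ⟨fun k _ => List.nodup_range', ?_⟩) ?_
    · refine (List.pairwise_lt_range' (s := 2) (n := numSegments A π - 1)).imp ?_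
      intro k k' hk j hj hj'
      have e1 := (hmem _ _).1 hj
      have e2 := (hmem _ _).1 hj'
      by_cases h0 : k = 0
      · subst h0
        simp at e1
        omega
      · have := beta_le_beta (A := A) (π := π) (m := 2 * k) (n := 2 * k' - 1) (by omega) (by omega)
        omega
    · intro j hj hj'
      obtain ⟨k, hk, hj'⟩ := List.mem_flatMap.1 hj'
      rw [List.mem_range'_1] at hk hj
      have e2 := (hmem _ _).1 hj'
      have := beta_le_beta (A := A) (π := π) (m := 2) (n := 2 * k - 1) (by omega) (by omega)
      omega
  · rw [List.mem_append, List.mem_flatMap, List.mem_filter, List.mem_range'_1, List.mem_range'_1,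
      decide_eq_true_eq]
    constructor
    · rintro (h | ⟨k, hk, hj⟩)
      · have hv := mem_verticalSteps_of_top h.1 (show j < beta A π 1 by omega)
        have := verticalSteps_bounds hv
        exact ⟨by omega, hv⟩
      · rw [List.mem_range'_1] at hk
        have hj := (hmem _ _).1 hj
        have hv := (mem_verticalSteps_iff_beta (A := A) (π := π) j).2
          ⟨k, by omega, by omega, hj.1, hj.2⟩
        have := verticalSteps_bounds hv
        have := beta_le_beta (A := A) (π := π) (m := 2) (n := 2 * k - 1) (by omega) (by omega)
        exact ⟨by omega, hv⟩
    · rintro ⟨h3, hv⟩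
      obtain ⟨k, hk1, hk, h4, h5⟩ := (mem_verticalSteps_iff_beta j).1 hv
      by_cases hk2 : k = 1
      · subst hk2
        have h4 : beta A π 2 ≤ j := h4
        exact Or.inl (by omega)
      · exact Or.inr ⟨k, List.mem_range'_1.2 (by omega), (hmem _ _).2 ⟨h4, h5⟩⟩

theorem geom_nonneg {q : ℝ} (hq : 0 < q) (t s : ℤ) : ∀ x ∈ geom q t s, 0 ≤ x := by
  intro x hx
  rw [geom_eq_map_range, List.mem_map] at hx
  obtain ⟨i, _, rfl⟩ := hx
  positivity

theorem initialVariables_nonneg {A : ℕ} {π : YoungDiagram} {q : ℝ} (hq : 0 < q) (a : ℕ) :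
    ∀ x ∈ initialVariables A π q a, 0 ≤ x := by
  intro x hx
  rw [initialVariables, List.mem_append, List.mem_flatMap] at hx
  rcases hx with hx | ⟨k, _, hx⟩ <;> exact geom_nonneg hq _ _ x hx

/-! ### The joint weight of the slices -/

theorem ofReal_schurWeight {A B : ℕ} {π : YoungDiagram} {q : ℝ} (hq : 0 < q) {m : ℕ}
    (α : Fin (m + 1) → ℕ) (lam : Fin (m + 1) → YoungDiagram) :
    0 ≤ schurWeight A B π q α lam ∧ ENNReal.ofReal (schurWeight A B π q α lam) =
      ENNReal.ofReal (schur (lam (Fin.last m)) (geom q 0 (B - π.rowLen 0 - 1))) *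
      (∏ k : Fin m, ENNReal.ofReal (skewSchur (lam k.succ) (lam k.castSucc)
        (geom q (A + π.rowLen 0 + 2 - α k.succ) (A + π.rowLen 0 + 1 - α k.castSucc)))) *
      ENNReal.ofReal (schur (lam 0) (initialVariables A π q (α 0))) := by
  have h1 := skewSchur_nonneg (lam (Fin.last m)) ⊥ _ (geom_nonneg hq 0 (B - π.rowLen 0 - 1))
  have h2 : ∀ k : Fin m, 0 ≤ skewSchur (lam k.succ) (lam k.castSucc)
      (geom q (A + π.rowLen 0 + 2 - α k.succ) (A + π.rowLen 0 + 1 - α k.castSucc)) :=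
    fun k => skewSchur_nonneg _ _ _ (geom_nonneg hq _ _)
  have h3 := skewSchur_nonneg (lam 0) ⊥ _ (initialVariables_nonneg (A := A) (π := π) hq (α 0))
  have h4 := Finset.prod_nonneg fun k (_ : k ∈ Finset.univ) => h2 k
  refine ⟨mul_nonneg (mul_nonneg h1 h4) h3, ?_⟩
  rw [schurWeight, schur, schur, ENNReal.ofReal_mul (mul_nonneg h1 h4), ENNReal.ofReal_mul h1,
    ENNReal.ofReal_prod_of_nonneg fun k _ => h2 k]

theorem segment_boundaryKernel (A : ℕ) (π : YoungDiagram) (q : ℝ) (a b : ℕ) :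
    Transfer.segment (boundaryKernel A π q) a b =
      (((List.range' a (b - a)).map (boundaryStep A π q)).map Transfer.letter).prod := by
  rw [Transfer.segment, List.map_map]
  rfl

theorem upWeights_boundaryStep (A : ℕ) (π : YoungDiagram) (q : ℝ) (l : List ℕ) :
    Transfer.upWeights (l.map (boundaryStep A π q)) =
      ((l.filter (· ∈ verticalSteps A π)).map (stepVariable A π q)).map ENNReal.ofReal := by
  induction l with
  | nil => rfl
  | cons k l ih =>
    rw [Transfer.upWeights] at ih ⊢
    by_cases hk : k ∈ verticalSteps A π
    · simp [boundaryStep, hk, stepVariable] at ih ⊢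
      exact ih
    · simp [boundaryStep, hk] at ih ⊢
      exact ih

theorem downWeights_boundaryStep (A : ℕ) (π : YoungDiagram) (q : ℝ) (l : List ℕ) :
    Transfer.downWeights (l.map (boundaryStep A π q)) =
      ((l.filter (· ∉ verticalSteps A π)).map fun k : ℕ =>
        q ^ ((k : ℤ) - ((A + π.rowLen 0 + 1 : ℕ) : ℤ))).map ENNReal.ofReal := by
  induction l with
  | nil => rfl
  | cons k l ih =>
    rw [Transfer.downWeights] at ih ⊢
    by_cases hk : k ∈ verticalSteps A π
    · simp [boundaryStep, hk] at ih ⊢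
      exact ih
    · simp [boundaryStep, hk] at ih ⊢
      exact ih

variable {A B : ℕ} {π : YoungDiagram} {q : ℝ}

/-- The part of the boundary before a point of the top vertical segment contributes a Schur
function, up to a constant. -/
theorem segment_initial (hq : 0 < q) {a : ℕ} (h2 : beta A π 2 ≤ a) (h1 : a ≤ beta A π 1) :
    ∃ c ≠ 0, ∀ lam, Transfer.segment (boundaryKernel A π q) 1 a ⊥ lam =
      c * ENNReal.ofReal (schur lam (initialVariables A π q a)) := by
  obtain ⟨c, hc, h⟩ := Transfer.word_bot_left
    ((List.range' 1 (a - 1)).map (boundaryStep A π q))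
  refine ⟨c, hc, fun lam => ?_⟩
  rw [segment_boundaryKernel, h, upWeights_boundaryStep, schur,
    ofReal_skewSchur_eq_prod _ _ _ (initialVariables_nonneg hq a),
    Transfer.prod_up_perm ((initialVariables_perm q h2 h1).map ENNReal.ofReal)]

/-- A part of the top vertical segment contributes a skew Schur function. -/
theorem segment_top (hq : 0 < q) {a b : ℕ} (h2 : beta A π 2 ≤ a) (h1 : b ≤ beta A π 1)
    (μ lam : YoungDiagram) : Transfer.segment (boundaryKernel A π q) a b μ lam =
      ENNReal.ofReal (skewSchur lam μ
        (geom q (A + π.rowLen 0 + 2 - b) (A + π.rowLen 0 + 1 - a))) := by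
  have h : (List.range' a (b - a)).map (boundaryKernel A π q) = (((List.range' a (b - a)).map
      (stepVariable A π q)).map ENNReal.ofReal).map Transfer.up := by
    rw [List.map_map, List.map_map]
    refine List.map_congr_left fun k hk => ?_
    rw [List.mem_range'_1] at hk
    rw [boundaryKernel_of_mem (mem_verticalSteps_of_top (h2.trans hk.1) (by omega))]
    rfl
  rw [ofReal_skewSchur_eq_prod _ _ _ (geom_nonneg hq _ _),
    Transfer.prod_up_perm ((geom_perm A π q b a).map ENNReal.ofReal), Transfer.segment, h]

/-- The part of the boundary after a point of the top vertical segment contributes a Schur function,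
up to a constant. -/
theorem segment_final (hπ : π ≤ rectangle A B) (hq : 0 < q) {a : ℕ} (h2 : beta A π 2 ≤ a)
    (h1 : a < beta A π 1) :
    ∃ c ≠ 0, ∀ lam, Transfer.segment (boundaryKernel A π q) a (A + B + 1) lam ⊥ =
      c * ENNReal.ofReal (schur lam (geom q 0 (B - π.rowLen 0 - 1))) := by
  obtain ⟨c, hc, h⟩ := Transfer.word_bot_right
    ((List.range' a (A + B + 1 - a)).map (boundaryStep A π q))
  refine ⟨c, hc, fun lam => ?_⟩
  have hb := beta_one (lt_of_le_of_lt (Nat.zero_le _) h1)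
  have hB := (rowLen_le_of_le_rectangle hπ 0).1
  have hfilter : (List.range' a (A + B + 1 - a)).filter (· ∉ verticalSteps A π) =
      List.range' (A + π.rowLen 0 + 1) (B - π.rowLen 0) := by
    have e := List.range'_append_1 (s := a) (m := A + π.rowLen 0 + 1 - a) (n := B - π.rowLen 0)
    rw [show a + (A + π.rowLen 0 + 1 - a) = A + π.rowLen 0 + 1 by omega,
      show A + π.rowLen 0 + 1 - a + (B - π.rowLen 0) = A + B + 1 - a by omega] at e
    rw [← e, List.filter_append, List.filter_eq_nil_iff.2, List.nil_append,
      List.filter_eq_self.2]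
    · intro k hk
      rw [List.mem_range'_1] at hk
      rw [decide_eq_true_eq]
      intro hv
      have := verticalSteps_bounds hv
      omega
    · intro k hk
      rw [List.mem_range'_1] at hk
      rw [decide_eq_true_eq, not_not]
      exact mem_verticalSteps_of_top (h2.trans hk.1) (by omega)
  have hvars : (List.range' (A + π.rowLen 0 + 1) (B - π.rowLen 0)).map (fun k : ℕ =>
      q ^ ((k : ℤ) - ((A + π.rowLen 0 + 1 : ℕ) : ℤ))) = geom q 0 (B - π.rowLen 0 - 1) := by
    rw [geom_eq_map_range, List.range'_eq_map_range, List.map_map]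
    have : ((B : ℤ) - π.rowLen 0 - 1 + 1 - 0).toNat = B - π.rowLen 0 := by omega
    rw [this]
    refine List.map_congr_left fun i _ => ?_
    rw [Function.comp_apply]
    congr 1
    push_cast
    ring
  rw [segment_boundaryKernel, h, downWeights_boundaryStep, hfilter, hvars, schur,
    ofReal_skewSchur_eq_prod _ _ _ (geom_nonneg hq _ _)]

open Classical in
/-- The total weight of the skew plane partitions with prescribed slices is a constant multiple of
the product of Schur functions. -/
theorem tsum_weight_slices (hπ : π ≤ rectangle A B) (hq : 0 < q) {m : ℕ} {α : Fin (m + 1) → ℕ}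
    (hα : StrictMono α) (h2 : beta A π 2 ≤ α 0) (h1 : α (Fin.last m) < beta A π 1) :
    ∃ c ≠ 0, ∀ lam : Fin (m + 1) → YoungDiagram,
      (∑' P : SkewPlanePartition A B π, if lam = slices α P then
        ENNReal.ofReal (q ^ P.volume) else 0) =
      c * ENNReal.ofReal (schurWeight A B π q α lam) := by
  have hle : ∀ i j, i ≤ j → α i ≤ α j := fun i j h => hα.monotone h
  have hb := beta_one (lt_of_le_of_lt (Nat.zero_le _) h1)
  have hB := (rowLen_le_of_le_rectangle hπ 0).1
  have hpos : 1 ≤ α 0 := (verticalSteps_bounds (mem_verticalSteps_of_top h2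
    ((hle 0 _ (Fin.zero_le _)).trans_lt h1))).1
  have hr : ∀ i, 1 ≤ α i ∧ α i ≤ A + B := fun i => by
    have := hle 0 i (Fin.zero_le _)
    have := hle i _ (Fin.le_last _)
    omega
  obtain ⟨c, hc, hinit⟩ := segment_initial hq h2 ((hle 0 _ (Fin.zero_le _)).trans h1.le)
  obtain ⟨d, hd, hfin⟩ := segment_final hπ hq (h2.trans (hle 0 _ (Fin.zero_le _))) h1
  refine ⟨c * d, mul_ne_zero hc hd, fun lam => ?_⟩
  have hiff : ∀ P : SkewPlanePartition A B π, lam = slices α P ↔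
      ∀ i : Fin (A + B), ∀ j, α j = 1 + i → P.slice (i + 1) = lam j := by
    intro P
    constructor
    · rintro rfl i j hj
      rw [slices, hj, add_comm]
    · intro h
      funext j
      have := h ⟨α j - 1, by have := hr j; omega⟩ j (by have := hr j; simp only; omega)
      rw [← this, slices]
      congr 1
      have := hr j
      simp only
      omega
  have hK := Transfer.segment_restrict_eq_prod (boundaryKernel A π q) hα lam hpos
    (N := A + B + 1) (by have := hr (Fin.last m); omega) ⊥ ⊥
  have hweight := tsum_weight_eq_prod hπ hq fun k κ => ∀ j, α j = k → κ = lam j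
  refine ((tsum_congr fun P => ?_).trans hweight).trans (hK.trans ?_)
  · by_cases h : lam = slices α P
    · rw [if_pos h, if_pos ((hiff P).1 h)]
    · rw [if_neg h, if_neg (mt (hiff P).2 h)]
  rw [hinit, hfin, (ofReal_schurWeight hq α lam).2]
  have hmid : ∏ i : Fin m, Transfer.segment (boundaryKernel A π q) (α i.castSucc) (α i.succ)
      (lam i.castSucc) (lam i.succ) = ∏ k : Fin m, ENNReal.ofReal (skewSchur (lam k.succ)
        (lam k.castSucc) (geom q (A + π.rowLen 0 + 2 - α k.succ)
          (A + π.rowLen 0 + 1 - α k.castSucc))) :=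
    Finset.prod_congr rfl fun i _ => segment_top hq (h2.trans (hle 0 _ (Fin.zero_le _)))
      ((hle _ _ (Fin.le_last _)).trans h1.le) _ _
  rw [hmid]
  ring

/-- The numbers `λ_i - i` are strictly decreasing, so that the set of their values determines
the sequence. -/
theorem pointConfiguration_injective (m : ℕ) :
    Function.Injective (pointConfiguration : (Fin (m + 1) → YoungDiagram) → _) := by
  intro lam mu h
  funext k
  have hmono : ∀ ν : YoungDiagram, StrictMono fun i : ℕ => (i : ℤ) + 1 - ν.rowLen i := by
    intro ν i j hij
    have := ν.rowLen_anti i j hij.le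
    simp only
    omega
  have hsub : ∀ {lam mu : Fin (m + 1) → YoungDiagram}, pointConfiguration lam =
      pointConfiguration mu → Set.range (fun i : ℕ => (i : ℤ) + 1 - (lam k).rowLen i) ⊆
        Set.range (fun i : ℕ => (i : ℤ) + 1 - (mu k).rowLen i) := by
    rintro lam mu h x ⟨i, rfl⟩
    obtain ⟨j, hj⟩ : (k, ((lam k).rowLen i : ℤ) - ((i : ℤ) + 1)) ∈ pointConfiguration mu :=
      h ▸ ⟨i, rfl⟩
    refine ⟨j, ?_⟩
    simp only at hj ⊢
    omega
  have := ((hmono (lam k)).range_inj (hmono (mu k))).1 ((hsub h).antisymm (hsub h.symm))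
  refine ext_rowLen fun i => ?_
  have := congrFun this i
  omega

end SkewPP

end

theorem mainTheorem5 (A B : ℕ) (π : YoungDiagram) (hπ : π ≤ SkewPP.rectangle A B)
    (q : ℝ) (hq0 : 0 < q) (hq1 : q < 1)
    (m : ℕ) (α : Fin (m + 1) → ℕ) (hα : StrictMono α)
    (hα_lower : SkewPP.beta A π 2 ≤ α 0) (hα_upper : α (Fin.last m) < SkewPP.beta A π 1) :
    Summable (SkewPP.schurWeight A B π q α) ∧
    (0 < ∑' mu, SkewPP.schurWeight A B π q α mu) ∧
    (∀ lam : Fin (m + 1) → YoungDiagram,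
      (((SkewPP.volumeMeasure A B π q hq0 hq1).map (SkewPP.slices α)) lam).toReal =
        SkewPP.schurWeight A B π q α lam / ∑' mu, SkewPP.schurWeight A B π q α mu) ∧
    (∀ lam : Fin (m + 1) → YoungDiagram,
      (((SkewPP.volumeMeasure A B π q hq0 hq1).map
          (fun P => SkewPP.pointConfiguration (SkewPP.slices α P)))
        (SkewPP.pointConfiguration lam)).toReal =
        SkewPP.schurWeight A B π q α lam / ∑' mu, SkewPP.schurWeight A B π q α mu) := by
  classical
  obtain ⟨c, hc, hweight⟩ := SkewPP.tsum_weight_slices hπ hq0 hα hα_lower hα_upper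
  set W := SkewPP.schurWeight A B π q α with hW
  have hW0 : ∀ lam, 0 ≤ W lam := fun lam => (SkewPP.ofReal_schurWeight hq0 α lam).1
  set T := ∑' P : SkewPP.SkewPlanePartition A B π, ENNReal.ofReal (q ^ P.volume) with hT
  have hT0 : T ≠ 0 := SkewPP.tsum_weight_ne_zero A B π q
  have hT1 : T ≠ ⊤ := SkewPP.tsum_weight_ne_top A B π q hq0 hq1
  -- Summing over all prescribed slices gives the total weight of all skew plane partitions.
  have htotal : T = c * ∑' lam, ENNReal.ofReal (W lam) := by
    rw [← ENNReal.tsum_mul_left, hT]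
    simp_rw [← hweight]
    rw [ENNReal.tsum_comm]
    refine tsum_congr fun P => ?_
    rw [tsum_eq_single (SkewPP.slices α P) fun _ h => if_neg h, if_pos rfl]
  have hS0 : ∑' lam, ENNReal.ofReal (W lam) ≠ 0 := fun h => hT0 (by rw [htotal, h, mul_zero])
  have hS1 : ∑' lam, ENNReal.ofReal (W lam) ≠ ⊤ := fun h =>
    hT1 (by rw [htotal, h, ENNReal.mul_top hc])
  have hc1 : c ≠ ⊤ := fun h => hT1 (by rw [htotal, h, ENNReal.top_mul hS0])
  have hsum : Summable W := by
    have := ENNReal.summable_toReal hS1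
    simpa only [ENNReal.toReal_ofReal (hW0 _)] using this
  have hofReal : ENNReal.ofReal (∑' lam, W lam) = ∑' lam, ENNReal.ofReal (W lam) :=
    ENNReal.ofReal_tsum_of_nonneg hW0 hsum
  have hpos : 0 < ∑' lam, W lam := by
    rw [← ENNReal.ofReal_pos, hofReal]
    exact pos_iff_ne_zero.2 hS0
  have hprob : ∀ lam, ((SkewPP.volumeMeasure A B π q hq0 hq1).map (SkewPP.slices α)) lam =
      ENNReal.ofReal (W lam / ∑' mu, W mu) := by
    intro lam
    have h1 : ((SkewPP.volumeMeasure A B π q hq0 hq1).map (SkewPP.slices α)) lam =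
        (c * ENNReal.ofReal (W lam)) * T⁻¹ := by
      rw [PMF.map_apply, ← hweight, ← ENNReal.tsum_mul_right]
      refine tsum_congr fun P => ?_
      rw [SkewPP.volumeMeasure, PMF.normalize_apply, ite_mul, zero_mul]
      split_ifs <;> rfl
    rw [h1, htotal, ← hofReal, ENNReal.ofReal_div_of_pos hpos, ← div_eq_mul_inv,
      ENNReal.mul_div_mul_left _ _ hc hc1]
  have hreal : ∀ lam, (((SkewPP.volumeMeasure A B π q hq0 hq1).map (SkewPP.slices α)) lam).toReal =
      W lam / ∑' mu, W mu := fun lam => by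
    rw [hprob, ENNReal.toReal_ofReal (div_nonneg (hW0 lam) hpos.le)]
  refine ⟨hsum, hpos, hreal, fun lam => ?_⟩
  rw [← hreal, PMF.map_apply, PMF.map_apply]
  congr 1
  refine tsum_congr fun P => ?_
  have := (SkewPP.pointConfiguration_injective m).eq_iff (a := lam) (b := SkewPP.slices α P)
  by_cases h : lam = SkewPP.slices α P
  · rw [if_pos h, if_pos (this.2 h)]
  · rw [if_neg h, if_neg (mt this.1 h)]
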